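/- Let $R$ and $S$ be associative rings with identity and let ${}_RC_S$ be a semidualizing $(R,S)$-bimodule: ${}_RC$ and $C_S$ admit degreewise finite projective resolutions (over $R$ and over $S^{op}$, respectively), the homothety maps $R\to\operatorname{Hom}_{S^{op}}(C,C)$ and $S\to\operatorname{Hom}_R(C,C)$ are isomorphisms, and $\operatorname{Ext}^{i}_R(C,C)=0=\operatorname{Ext}^{i}_{S^{op}}(C,C)$ for all $i\ge 1$. Let $\mathcal{A}_C(S)$ be the Auslander class, that is, the class of all left $S$-modules $N$ such that $\operatorname{Tor}_i^S(C,N)=0$ and $\operatorname{Ext}^i_R(C,C\otimes_SN)=0$ for all $i\ge 1$ and the canonical map $\mu_N:N\to\operatorname{Hom}_R(C,C\otimes_SN)$, $\mu_N(x)(c)=c\otimes x$, is an isomorphism. Let $\mathcal{I}_C(S)$ be the class of all left $S$-modules isomorphic to $\operatorname{Hom}_R(C,I)$ for some injective left $R$-module $I$. For a class $\mathscr{X}$ of left $S$-modules closed under isomorphisms, the $\mathscr{X}$-projective dimension $\mathscr{X}\text{-}\mathrm{pd}_S\,N$ of a left $S$-module $N$ is the infimum of all integers $n\ge 0$ for which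 there is an exact sequence $0\to X_n\to\cdots\to X_1\to X_0\to N\to 0$ of left $S$-modules with all $X_i\in\mathscr{X}$ (and $\infty$ if there is none). Let $N$ be a left $S$-module with $\mathcal{A}_C(S)\text{-}\mathrm{pd}_S\,N=n<\infty$. Then there exist exact sequences of left $S$-modules $$0\to H\to A\to N\to 0\qquad\text{and}\qquad 0\to N\to H'\to A'\to 0$$ with $A,A'\in\mathcal{A}_C(S)$, such that $\mathcal{I}_C(S)\text{-}\mathrm{pd}_S\,H=n-1$ if $n\ge 1$ and $H=0$ if $n=0$, and $\mathcal{I}_C(S)\text{-}\mathrm{pd}_S\,H'=n$. -/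

import Mathlib

open CategoryTheory
open scoped TensorProduct

universe u

/-! Conventions: `R` and `S` are arbitrary (associative, unital) rings. An `(R, S)`-bimodule `C` is an
abelian group with a left `R`-module structure and a right `S`-module structure, the latter written as a
left module structure over the opposite ring (`MulOpposite.op s • c` is `c s`), which commute. -/

namespace SemidualizingBimodule

section Bimodule

variable (R S : Type u) [Ring R] [Ring S]
variable (C : Type u) [AddCommGroup C] [Module R C] [Module Sᵐᵒᵖ C] [SMulCommClass R Sᵐᵒᵖ C]

/-! ### The homothety maps and semidualizing bimodules -/

/-- The homothety map `R → Hom_{S^op}(C, C)`, `r ↦ (c ↦ r c)`. -/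
def homothetyLeft (r : R) : C →ₗ[Sᵐᵒᵖ] C where
  toFun c := r • c
  map_add' := smul_add r
  map_smul' s c := smul_comm r s c

/-- The homothety map `S → Hom_R(C, C)`, `s ↦ (c ↦ c s)`. -/
def homothetyRight (s : S) : C →ₗ[R] C where
  toFun c := MulOpposite.op s • c
  map_add' := smul_add (MulOpposite.op s)
  map_smul' r c := (smul_comm r (MulOpposite.op s) c).symm

/-- A module admits a degreewise finite projective resolution: a projective resolution all of whose
terms are finitely generated (projective) modules. -/
def HasDegreewiseFiniteProjectiveResolution {A : Type u} [Ring A] (M : ModuleCat.{u} A) : Prop :=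
  ∃ P : ProjectiveResolution M, ∀ i : ℕ, Module.Finite A (P.complex.X i)

/-- The `(R, S)`-bimodule `C` is semidualizing. -/
structure IsSemidualizing : Prop where
  /-- `C` has a degreewise finite projective resolution as a left `R`-module. -/
  finite_left : HasDegreewiseFiniteProjectiveResolution (ModuleCat.of R C)
  /-- `C` has a degreewise finite projective resolution as a right `S`-module. -/
  finite_right : HasDegreewiseFiniteProjectiveResolution (ModuleCat.of Sᵐᵒᵖ C)
  /-- The homothety map `R → Hom_{S^op}(C, C)` is an isomorphism. -/
  bijective_homothetyLeft : Function.Bijective (homothetyLeft R S C)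
  /-- The homothety map `S → Hom_R(C, C)` is an isomorphism. -/
  bijective_homothetyRight : Function.Bijective (homothetyRight R S C)
  /-- `Ext_R^i(C, C) = 0` for all `i ≥ 1`. -/
  ext_left : ∀ i : ℕ, 1 ≤ i →
    Subsingleton (Abelian.Ext (ModuleCat.of R C) (ModuleCat.of R C) i)
  /-- `Ext_{S^op}^i(C, C) = 0` for all `i ≥ 1`. -/
  ext_right : ∀ i : ℕ, 1 ≤ i →
    Subsingleton (Abelian.Ext (ModuleCat.of Sᵐᵒᵖ C) (ModuleCat.of Sᵐᵒᵖ C) i)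

/-! ### The tensor product `C ⊗_S N` over the noncommutative ring `S` -/

/-- The relations `(c s) ⊗ x - c ⊗ (s x)` in `C ⊗_ℤ N`. Since
`r ((c s) ⊗ x - c ⊗ (s x)) = ((r c) s) ⊗ x - (r c) ⊗ (s x)`, the set of these generators is stable under
`R`, so that the `R`-submodule they span is also the subgroup they generate (`balancedRel_toAddSubgroup`). -/
def balancedRel (N : Type u) [AddCommGroup N] [Module S N] : Submodule R (C ⊗[ℤ] N) :=
  Submodule.span R
    {t | ∃ (c : C) (s : S) (x : N), t = (MulOpposite.op s • c) ⊗ₜ[ℤ] x - c ⊗ₜ[ℤ] (s • x)}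

theorem balancedRel_toAddSubgroup (N : Type u) [AddCommGroup N] [Module S N] :
    (balancedRel R S C N).toAddSubgroup = AddSubgroup.closure
      {t | ∃ (c : C) (s : S) (x : N),
        t = (MulOpposite.op s • c) ⊗ₜ[ℤ] x - c ⊗ₜ[ℤ] (s • x)} := by
  apply le_antisymm
  · intro t ht
    refine Submodule.span_induction (fun y hy => AddSubgroup.subset_closure hy)
      (AddSubgroup.zero_mem _) (fun y z _ _ hy hz => AddSubgroup.add_mem _ hy hz) ?_ ht
    intro r y hy' hy
    clear hy'
    induction hy using AddSubgroup.closure_induction with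
    | mem y hy =>
      obtain ⟨c, s, x, rfl⟩ := hy
      refine AddSubgroup.subset_closure ⟨r • c, s, x, ?_⟩
      rw [smul_sub, TensorProduct.smul_tmul', TensorProduct.smul_tmul', smul_comm]
    | zero => rw [smul_zero]; exact AddSubgroup.zero_mem _
    | add y z _ _ hy hz => rw [smul_add]; exact AddSubgroup.add_mem _ hy hz
    | neg y _ hy => rw [smul_neg]; exact AddSubgroup.neg_mem _ hy
  · rw [AddSubgroup.closure_le]
    intro t ht
    exact Submodule.subset_span ht

/-- The tensor product `C ⊗_S N` of the `(R, S)`-bimodule `C` with the left `S`-module `N`,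
as a left `R`-module. -/
abbrev BalancedTensor (N : Type u) [AddCommGroup N] [Module S N] : Type u :=
  (C ⊗[ℤ] N) ⧸ balancedRel R S C N

/-- The class `c ⊗ x` in `C ⊗_S N`. -/
def BalancedTensor.tmul {N : Type u} [AddCommGroup N] [Module S N] (c : C) (x : N) :
    BalancedTensor R S C N :=
  (balancedRel R S C N).mkQ (c ⊗ₜ[ℤ] x)

/-- The `R`-linear map `C ⊗_S f : C ⊗_S N → C ⊗_S N'`, `c ⊗ x ↦ c ⊗ f x`. -/
def BalancedTensor.map {N N' : Type u} [AddCommGroup N] [Module S N] [AddCommGroup N'] [Module S N']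
    (f : N →ₗ[S] N') : BalancedTensor R S C N →ₗ[R] BalancedTensor R S C N' :=
  Submodule.mapQ _ _ (TensorProduct.AlgebraTensorModule.map (LinearMap.id : C →ₗ[R] C)
      (f.toAddMonoidHom.toIntLinearMap)) (by
    refine Submodule.span_le.2 ?_
    rintro _ ⟨c, s, x, rfl⟩
    refine Submodule.subset_span ⟨c, s, f x, ?_⟩
    simp)

/-- The functor `C ⊗_S - : Mod S ⥤ Mod R`. -/
def tensorFunctor : ModuleCat.{u} S ⥤ ModuleCat.{u} R where
  obj N := ModuleCat.of R (BalancedTensor R S C N)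
  map f := ModuleCat.ofHom (BalancedTensor.map R S C f.hom)
  map_id N := by
    apply ModuleCat.hom_ext
    apply Submodule.linearMap_qext
    apply TensorProduct.AlgebraTensorModule.ext
    intro c x
    rfl
  map_comp f g := by
    apply ModuleCat.hom_ext
    apply Submodule.linearMap_qext
    apply TensorProduct.AlgebraTensorModule.ext
    intro c x
    rfl

instance : (tensorFunctor R S C).Additive where
  map_add {N N' f g} := by
    apply ModuleCat.hom_ext
    apply Submodule.linearMap_qext
    apply TensorProduct.AlgebraTensorModule.ext
    intro c x
    change (balancedRel R S C N').mkQ (c ⊗ₜ[ℤ] (f.hom x + g.hom x)) =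
      (balancedRel R S C N').mkQ (c ⊗ₜ[ℤ] f.hom x) + (balancedRel R S C N').mkQ (c ⊗ₜ[ℤ] g.hom x)
    rw [TensorProduct.tmul_add, map_add]

/-- `Tor_i^S(C, N)`, the `i`-th left derived functor of `C ⊗_S -` at `N`
(with its natural left `R`-module structure). -/
noncomputable def tor (i : ℕ) (N : ModuleCat.{u} S) : ModuleCat.{u} R :=
  ((tensorFunctor R S C).leftDerived i).obj N

/-! ### The left `S`-module `M_* = Hom_R(C, M)` -/

/-- `M_* = Hom_R(C, M)`, as a type separate from `C →ₗ[R] M` so that it carries only the left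
`S`-module structure `(s f)(c) = f (c s)`. -/
def HomModule (M : Type u) [AddCommGroup M] [Module R M] : Type u := C →ₗ[R] M

instance (M : Type u) [AddCommGroup M] [Module R M] : AddCommGroup (HomModule R C M) :=
  inferInstanceAs (AddCommGroup (C →ₗ[R] M))

/-- The left `S`-module structure `(s f)(c) = f (c s)` on `Hom_R(C, M)`. -/
instance (M : Type u) [AddCommGroup M] [Module R M] : Module S (HomModule R C M) where
  smul s f := LinearMap.comp (show C →ₗ[R] M from f) (homothetyRight R S C s)
  one_smul f := by
    apply LinearMap.ext
    intro c
    change (show C →ₗ[R] M from f) (MulOpposite.op (1 : S) • c) = _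
    rw [MulOpposite.op_one, one_smul]
  mul_smul s t f := by
    apply LinearMap.ext
    intro c
    change (show C →ₗ[R] M from f) (MulOpposite.op (s * t) • c) =
      (show C →ₗ[R] M from f) (MulOpposite.op t • MulOpposite.op s • c)
    rw [MulOpposite.op_mul, mul_smul]
  smul_zero _ := rfl
  smul_add _ _ _ := rfl
  add_smul s t f := by
    apply LinearMap.ext
    intro c
    change (show C →ₗ[R] M from f) (MulOpposite.op (s + t) • c) =
      (show C →ₗ[R] M from f) (MulOpposite.op s • c) +
        (show C →ₗ[R] M from f) (MulOpposite.op t • c)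
    rw [MulOpposite.op_add, add_smul, map_add]
  zero_smul f := by
    apply LinearMap.ext
    intro c
    change (show C →ₗ[R] M from f) (MulOpposite.op (0 : S) • c) = 0
    rw [MulOpposite.op_zero, zero_smul, map_zero]

/-- The canonical valuation homomorphism `μ_N : N → Hom_R(C, C ⊗_S N)`, `μ_N(x)(c) = c ⊗ x`. -/
def valuation (N : Type u) [AddCommGroup N] [Module S N] :
    N →ₗ[S] HomModule R C (BalancedTensor R S C N) where
  toFun x := (show C →ₗ[R] BalancedTensor R S C N from
    { toFun := fun c => BalancedTensor.tmul R S C c x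
      map_add' := fun c c' => by
        unfold BalancedTensor.tmul
        rw [TensorProduct.add_tmul, map_add]
      map_smul' := fun r c => by
        unfold BalancedTensor.tmul
        rw [RingHom.id_apply, ← map_smul, TensorProduct.smul_tmul'] })
  map_add' x y := by
    apply LinearMap.ext
    intro c
    change (balancedRel R S C N).mkQ (c ⊗ₜ[ℤ] (x + y)) =
      (balancedRel R S C N).mkQ (c ⊗ₜ[ℤ] x) + (balancedRel R S C N).mkQ (c ⊗ₜ[ℤ] y)
    rw [TensorProduct.tmul_add, map_add]
  map_smul' s x := by
    apply LinearMap.ext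
    intro c
    change (balancedRel R S C N).mkQ (c ⊗ₜ[ℤ] (s • x)) =
      (balancedRel R S C N).mkQ ((MulOpposite.op s • c) ⊗ₜ[ℤ] x)
    refine Eq.symm ((Submodule.Quotient.eq _).2 ?_)
    exact Submodule.subset_span ⟨c, s, x, rfl⟩

/-! ### The Auslander class and the `C`-injective modules -/

/-- Membership in the Auslander class `𝒜_C(S)`. -/
structure InAuslanderClass (N : ModuleCat.{u} S) : Prop where
  /-- `Tor_i^S(C, N) = 0` for all `i ≥ 1`. -/
  tor_eq_zero : ∀ i : ℕ, 1 ≤ i → Subsingleton (tor R S C i N)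
  /-- `Ext_R^i(C, C ⊗_S N) = 0` for all `i ≥ 1`. -/
  ext_eq_zero : ∀ i : ℕ, 1 ≤ i →
    Subsingleton (Abelian.Ext (ModuleCat.of R C) (ModuleCat.of R (BalancedTensor R S C N)) i)
  /-- `μ_N` is an isomorphism. -/
  bijective_valuation : Function.Bijective (valuation R S C N)

/-- The Auslander class `𝒜_C(S)`, as a full subcategory of `Mod S`. -/
def auslanderClass : ObjectProperty (ModuleCat.{u} S) := fun N => InAuslanderClass R S C N

/-- The class `ℐ_C(S)` of `C`-injective modules: the `S`-modules isomorphic to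
`I_* = Hom_R(C, I)` for some injective left `R`-module `I`. -/
def cInjective : ObjectProperty (ModuleCat.{u} S) := fun N =>
  ∃ I : ModuleCat.{u} R, Injective I ∧ Nonempty (N ≃ₗ[S] HomModule R C I)

end Bimodule

/-! ### Projective dimension relative to a class of modules -/

section RelativeDimension

variable {S : Type u} [Ring S]

/-- There is an exact sequence `0 → X_n → ⋯ → X_1 → X_0 → N → 0` with all `X_i` in `𝒳`
(the sequence is continued to the left by zero modules `X_i`, `i > n`). -/
def HasResolutionOfLength (𝒳 : ObjectProperty (ModuleCat.{u} S)) (N : ModuleCat.{u} S) (n : ℕ) :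
    Prop :=
  ∃ (X : ℕ → ModuleCat.{u} S) (d : ∀ i : ℕ, X (i + 1) →ₗ[S] X i) (ε : X 0 →ₗ[S] N),
    (∀ i : ℕ, i ≤ n → 𝒳 (X i)) ∧ (∀ i : ℕ, n < i → Subsingleton (X i)) ∧
    Function.Surjective ε ∧ Function.Exact (d 0) ε ∧
    ∀ i : ℕ, Function.Exact (d (i + 1)) (d i)

/-- The `𝒳`-projective dimension of `N`: the least `n ≥ 0` such that there is an exact sequence
`0 → X_n → ⋯ → X_0 → N → 0` with all `X_i` in `𝒳`, and `⊤` (infinity) if there is none. -/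
noncomputable def relPd (𝒳 : ObjectProperty (ModuleCat.{u} S)) (N : ModuleCat.{u} S) : ℕ∞ :=
  ⨅ (n : ℕ) (_ : HasResolutionOfLength 𝒳 N n), (n : ℕ∞)

end RelativeDimension

end SemidualizingBimodule

set_option linter.unusedSectionVars false

/-! This is Auslander–Buchweitz approximation for `cInjective` inside `auslanderClass`. The formal
half, `IsCogeneratedBy.exists_approximations`, only needs a class 𝒜 closed under isomorphisms,
extensions and kernels of epimorphisms, and a subclass ℐ such that every object of 𝒜 embeds into one
of ℐ with cokernel in 𝒜. It goes by induction on the length of an 𝒜-resolution. Pushing 0 → K → X →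
N → 0 out along the sequence 0 → K → K' → B → 0 already obtained for K gives 0 → K' → Q → N → 0,
where Q is an extension of B by X and so lies in 𝒜. Embedding Q into some U in ℐ and dividing by K'
gives the second sequence. The dimensions are sharp because a shorter ℐ-resolution of H or H' would
yield too short an 𝒜-resolution of N (`IsCogeneratedBy.hasResolutionOfLength_left` for H').

The other half is `IsSemidualizing.isCogeneratedBy`. Write M⁺ = Hom_ℤ(M, ℚ/ℤ). By adjunction,
Tor_i(C, N) vanishes exactly when Ext^i(N, C⁺) does (`tor_subsingleton_iff`), so the closure
properties follow from long exact Ext sequences and the short five lemma. For I injective, the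
evaluation C ⊗ Hom_R(C, I) → I is bijective (`IsSemidualizing.evaluation_bijective`), which settles
the Ext and valuation conditions for Hom_R(C, I). Its Tor condition is dimension shifting along
finitely generated projective modules P over C_S, for which P⁺ is injective
(`ext_homModule_character`). Finally, N in the Auslander class embeds into Hom_R(C, I) for any
injective I containing C ⊗ N. -/

namespace SemidualizingBimodule

/-! ### Exactness of abelian groups tested by characters into ℚ/ℤ. -/

section Characters

/-- Exactness of a pair of additive maps with zero composite is detected by characters. -/
theorem exact_iff_forall_character {A B D : Type*} [AddCommGroup A] [AddCommGroup B]
    [AddCommGroup D] (f : A →+ B) (g : B →+ D) (hfg : ∀ a, g (f a) = 0) :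
    Function.Exact f g ↔ ∀ φ : B →+ AddCircle (1 : ℚ), (∀ a, φ (f a) = 0) →
      ∃ ψ : D →+ AddCircle (1 : ℚ), ∀ b, ψ (g b) = φ b := by
  constructor
  · intro h φ hφ
    have hker : g.ker ≤ φ.ker := by
      intro b hb
      obtain ⟨a, rfl⟩ := (h b).1 hb
      exact hφ a
    obtain ⟨ψ, hψ⟩ := (Module.Baer.of_divisible (AddCircle (1 : ℚ))).extension_property_addMonoidHom
      (QuotientAddGroup.kerLift g) (QuotientAddGroup.kerLift_injective g)
      (QuotientAddGroup.lift g.ker φ hker)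
    exact ⟨ψ, fun b => DFunLike.congr_fun hψ (QuotientAddGroup.mk b)⟩
  · intro h b
    refine ⟨fun hb => ?_, by rintro ⟨a, rfl⟩; exact hfg a⟩
    -- If b is not in the image of f, a character of B / im f that is nonzero at b vanishes on im f
    -- but cannot factor through g, as g b = 0.
    by_contra hne
    have hq : (QuotientAddGroup.mk b : B ⧸ f.range) ≠ 0 := by
      rwa [Ne, QuotientAddGroup.eq_zero_iff]
    obtain ⟨χ, hχ⟩ := CharacterModule.exists_character_apply_ne_zero_of_ne_zero hq
    let χ' : (B ⧸ f.range) →+ AddCircle (1 : ℚ) := χ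
    obtain ⟨ψ, hψ⟩ := h (χ'.comp (QuotientAddGroup.mk' f.range)) (fun a => by
      have : (QuotientAddGroup.mk' f.range) (f a) = 0 :=
        (QuotientAddGroup.eq_zero_iff _).2 ⟨a, rfl⟩
      rw [AddMonoidHom.comp_apply, this, map_zero])
    exact hχ ((hψ b).symm.trans (by rw [hb, map_zero]))

/-- Injectivity of an additive map is detected by characters. -/
theorem injective_iff_forall_character {B D : Type*} [AddCommGroup B]
    [AddCommGroup D] (g : B →+ D) :
    Function.Injective g ↔ ∀ φ : B →+ AddCircle (1 : ℚ),
      ∃ ψ : D →+ AddCircle (1 : ℚ), ∀ b, ψ (g b) = φ b := by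
  have h := exact_iff_forall_character (0 : PUnit.{1} →+ B) g (fun _ => map_zero g)
  rw [injective_iff_map_eq_zero]
  constructor
  · intro hg φ
    refine h.1 (fun b => ⟨fun hb => ⟨0, (hg b hb).symm⟩, ?_⟩) φ (fun _ => map_zero φ)
    rintro ⟨_, rfl⟩
    exact map_zero g
  · intro hφ b hb
    obtain ⟨_, rfl⟩ := (h.2 (fun φ _ => hφ φ) b).1 hb
    rfl

end Characters

/-! ### The exact contravariant functor M ↦ M⁺ from right to left modules. -/

section RightCharacterModule

variable (S : Type u) [Ring S]

/-- The character group `Hom_ℤ(M, ℚ/ℤ)` of a right `S`-module `M`, as a left `S`-module via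
`(s φ)(m) = φ (m s)`. -/
def RightCharacterModule (M : Type u) [AddCommGroup M] [Module Sᵐᵒᵖ M] : Type u :=
  M →+ AddCircle (1 : ℚ)

variable {S} {M M' : Type u} [AddCommGroup M] [Module Sᵐᵒᵖ M] [AddCommGroup M'] [Module Sᵐᵒᵖ M']

instance : AddCommGroup (RightCharacterModule S M) :=
  inferInstanceAs (AddCommGroup (M →+ AddCircle (1 : ℚ)))

instance : FunLike (RightCharacterModule S M) M (AddCircle (1 : ℚ)) :=
  inferInstanceAs (FunLike (M →+ AddCircle (1 : ℚ)) M (AddCircle (1 : ℚ)))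

instance : AddMonoidHomClass (RightCharacterModule S M) M (AddCircle (1 : ℚ)) :=
  inferInstanceAs (AddMonoidHomClass (M →+ AddCircle (1 : ℚ)) M (AddCircle (1 : ℚ)))

@[ext] theorem RightCharacterModule.ext {φ ψ : RightCharacterModule S M}
    (h : ∀ m, φ m = ψ m) : φ = ψ := DFunLike.ext _ _ h

@[simp] theorem RightCharacterModule.add_apply (φ ψ : RightCharacterModule S M) (m : M) :
    (φ + ψ) m = φ m + ψ m := rfl

@[simp] theorem RightCharacterModule.zero_apply (m : M) :
    (0 : RightCharacterModule S M) m = 0 := rfl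

instance : Module S (RightCharacterModule S M) where
  smul s φ := AddMonoidHom.comp (show M →+ AddCircle (1 : ℚ) from φ)
    (DistribSMul.toAddMonoidHom M (MulOpposite.op s))
  one_smul φ := RightCharacterModule.ext fun m => by
    change φ (MulOpposite.op (1 : S) • m) = φ m
    rw [MulOpposite.op_one, one_smul]
  mul_smul s t φ := RightCharacterModule.ext fun m => by
    change φ (MulOpposite.op (s * t) • m) = φ (MulOpposite.op t • MulOpposite.op s • m)
    rw [MulOpposite.op_mul, mul_smul]
  smul_zero _ := rfl
  smul_add _ _ _ := rfl
  add_smul s t φ := RightCharacterModule.ext fun m => by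
    change φ (MulOpposite.op (s + t) • m) =
      φ (MulOpposite.op s • m) + φ (MulOpposite.op t • m)
    rw [MulOpposite.op_add, add_smul, map_add]
  zero_smul φ := RightCharacterModule.ext fun m => by
    change φ (MulOpposite.op (0 : S) • m) = 0
    rw [MulOpposite.op_zero, zero_smul, map_zero]

@[simp] theorem RightCharacterModule.smul_apply (s : S) (φ : RightCharacterModule S M) (m : M) :
    (s • φ) m = φ (MulOpposite.op s • m) := rfl

/-- Restriction of characters along a map of right modules. -/
def RightCharacterModule.map (f : M →ₗ[Sᵐᵒᵖ] M') :
    RightCharacterModule S M' →ₗ[S] RightCharacterModule S M where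
  toFun φ := AddMonoidHom.comp (show M' →+ AddCircle (1 : ℚ) from φ) f.toAddMonoidHom
  map_add' _ _ := rfl
  map_smul' s φ := RightCharacterModule.ext fun m => by
    change φ (MulOpposite.op s • f m) = φ (f (MulOpposite.op s • m))
    rw [map_smul f]

@[simp] theorem RightCharacterModule.map_apply (f : M →ₗ[Sᵐᵒᵖ] M')
    (φ : RightCharacterModule S M') (m : M) : RightCharacterModule.map f φ m = φ (f m) := rfl

theorem RightCharacterModule.map_surjective (f : M →ₗ[Sᵐᵒᵖ] M') (hf : Function.Injective f) :
    Function.Surjective (RightCharacterModule.map f) := fun φ => by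
  obtain ⟨ψ, hψ⟩ := (injective_iff_forall_character f.toAddMonoidHom).1 hf φ
  exact ⟨ψ, RightCharacterModule.ext hψ⟩

theorem RightCharacterModule.map_injective (f : M →ₗ[Sᵐᵒᵖ] M') (hf : Function.Surjective f) :
    Function.Injective (RightCharacterModule.map f) := fun φ ψ h => by
  ext m
  obtain ⟨x, rfl⟩ := hf m
  exact DFunLike.congr_fun h x

theorem RightCharacterModule.map_exact {M'' : Type u} [AddCommGroup M''] [Module Sᵐᵒᵖ M'']
    (f : M →ₗ[Sᵐᵒᵖ] M') (g : M' →ₗ[Sᵐᵒᵖ] M'') (hfg : Function.Exact f g) :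
    Function.Exact (RightCharacterModule.map g) (RightCharacterModule.map f) := by
  intro φ
  constructor
  · intro h
    obtain ⟨ψ, hψ⟩ := (exact_iff_forall_character f.toAddMonoidHom g.toAddMonoidHom
      hfg.apply_apply_eq_zero).1 hfg φ (fun a => DFunLike.congr_fun h a)
    exact ⟨ψ, RightCharacterModule.ext hψ⟩
  · rintro ⟨ψ, rfl⟩
    ext m
    simp [hfg.apply_apply_eq_zero]

end RightCharacterModule

/-! ### The balanced tensor product and its adjunction with characters. -/

section Tensor

variable {R S : Type u} [Ring R] [Ring S]
variable {C : Type u} [AddCommGroup C] [Module R C] [Module Sᵐᵒᵖ C] [SMulCommClass R Sᵐᵒᵖ C]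
variable {N N' N'' : Type u} [AddCommGroup N] [Module S N] [AddCommGroup N'] [Module S N']
  [AddCommGroup N''] [Module S N'']

@[elab_as_elim]
theorem BalancedTensor.induction {p : BalancedTensor R S C N → Prop}
    (t : BalancedTensor R S C N)
    (tmul : ∀ c x, p (BalancedTensor.tmul R S C c x))
    (add : ∀ y z, p y → p z → p (y + z)) : p t := by
  obtain ⟨t, rfl⟩ := Submodule.mkQ_surjective _ t
  induction t using TensorProduct.induction_on with
  | zero =>
    have := tmul 0 0
    rwa [BalancedTensor.tmul, TensorProduct.zero_tmul] at this
  | tmul c x => exact tmul c x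
  | add y z hy hz => rw [map_add]; exact add _ _ hy hz

theorem BalancedTensor.tmul_smul (c : C) (s : S) (x : N) :
    BalancedTensor.tmul R S C c (s • x) = BalancedTensor.tmul R S C (MulOpposite.op s • c) x :=
  Eq.symm ((Submodule.Quotient.eq _).2 (Submodule.subset_span ⟨c, s, x, rfl⟩))

theorem BalancedTensor.tmul_add (c : C) (x y : N) :
    BalancedTensor.tmul R S C c (x + y) =
      BalancedTensor.tmul R S C c x + BalancedTensor.tmul R S C c y := by
  simp only [BalancedTensor.tmul, TensorProduct.tmul_add, map_add]

theorem BalancedTensor.add_tmul (c d : C) (x : N) :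
    BalancedTensor.tmul R S C (c + d) x =
      BalancedTensor.tmul R S C c x + BalancedTensor.tmul R S C d x := by
  simp only [BalancedTensor.tmul, TensorProduct.add_tmul, map_add]

theorem BalancedTensor.tmul_zero (c : C) : BalancedTensor.tmul R S C c (0 : N) = 0 := by
  simp only [BalancedTensor.tmul, TensorProduct.tmul_zero, map_zero]

theorem BalancedTensor.smul_tmul (r : R) (c : C) (x : N) :
    BalancedTensor.tmul R S C (r • c) x = r • BalancedTensor.tmul R S C c x := by
  simp only [BalancedTensor.tmul, ← map_smul, TensorProduct.smul_tmul']

@[simp] theorem BalancedTensor.map_tmul (f : N →ₗ[S] N') (c : C) (x : N) :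
    BalancedTensor.map R S C f (BalancedTensor.tmul R S C c x) =
      BalancedTensor.tmul R S C c (f x) := rfl

/-- A balanced biadditive map induces an additive map on the tensor product. -/
noncomputable def BalancedTensor.lift {A : Type*} [AddCommGroup A] (b : C →+ N →+ A)
    (hb : ∀ (c : C) (s : S) (x : N), b (MulOpposite.op s • c) x = b c (s • x)) :
    BalancedTensor R S C N →+ A :=
  ((((balancedRel R S C N).restrictScalars ℤ).liftQ
    (TensorProduct.liftAddHom b (fun n c x => by simp)).toIntLinearMap (by
      intro t ht
      have ht' : t ∈ (balancedRel R S C N).toAddSubgroup := ht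
      rw [balancedRel_toAddSubgroup] at ht'
      rw [LinearMap.mem_ker, AddMonoidHom.coe_toIntLinearMap]
      refine AddSubgroup.closure_le (TensorProduct.liftAddHom b _).ker |>.2 ?_ ht'
      rintro _ ⟨c, s, x, rfl⟩
      change (TensorProduct.liftAddHom b _) _ = 0
      rw [map_sub, TensorProduct.liftAddHom_tmul, TensorProduct.liftAddHom_tmul, hb, sub_self])) ∘ₗ
    (Submodule.Quotient.restrictScalarsEquiv ℤ (balancedRel R S C N)).symm.toLinearMap).toAddMonoidHom

/-- A character of `C ⊗_S N` is a linear map from `N` to the character module of `C`. -/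
def BalancedTensor.curry (φ : BalancedTensor R S C N →+ AddCircle (1 : ℚ)) :
    N →ₗ[S] RightCharacterModule S C where
  toFun x := AddMonoidHom.mk' (fun c => φ (BalancedTensor.tmul R S C c x))
    (fun c d => by rw [BalancedTensor.add_tmul, map_add])
  map_add' x y := RightCharacterModule.ext fun c => by
    change φ _ = φ _ + φ _
    rw [BalancedTensor.tmul_add, map_add]
  map_smul' s x := RightCharacterModule.ext fun c => by
    exact congrArg φ (BalancedTensor.tmul_smul c s x)

@[simp] theorem BalancedTensor.curry_apply (φ : BalancedTensor R S C N →+ AddCircle (1 : ℚ))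
    (x : N) (c : C) : BalancedTensor.curry φ x c = φ (BalancedTensor.tmul R S C c x) := rfl

-- Together with `BalancedTensor.curry` this is the adjunction (C ⊗_S N)⁺ ≅ Hom_S(N, C⁺); only
-- existence is recorded, since uniqueness is `BalancedTensor.addHom_ext`.
variable (R) in
theorem BalancedTensor.exists_character (f : N →ₗ[S] RightCharacterModule S C) :
    ∃ φ : BalancedTensor R S C N →+ AddCircle (1 : ℚ),
      ∀ c x, φ (BalancedTensor.tmul R S C c x) = f x c := by
  refine ⟨BalancedTensor.lift (AddMonoidHom.mk' (fun c => AddMonoidHom.mk' (fun x => f x c)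
    (fun x y => by simp)) (fun c d => by ext x; simp)) (fun c s x => by simp), fun c x => rfl⟩

theorem BalancedTensor.addHom_ext {A : Type*} [AddCommGroup A]
    {φ ψ : BalancedTensor R S C N →+ A}
    (h : ∀ c x, φ (BalancedTensor.tmul R S C c x) = ψ (BalancedTensor.tmul R S C c x)) :
    φ = ψ := by
  ext t
  induction t using BalancedTensor.induction with
  | tmul c x => exact h c x
  | add y z hy hz => rw [map_add, map_add, hy, hz]

/-- Injectivity means that all characters extend, and under the adjunction a character of C ⊗ N
extends along C ⊗ f exactly when the corresponding map N → C⁺ extends along f. -/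
theorem BalancedTensor.map_injective_iff (f : N →ₗ[S] N') :
    Function.Injective (BalancedTensor.map R S C f) ↔
      ∀ g : N →ₗ[S] RightCharacterModule S C, ∃ h : N' →ₗ[S] RightCharacterModule S C,
        h ∘ₗ f = g := by
  refine (injective_iff_forall_character (BalancedTensor.map R S C f).toAddMonoidHom).trans ?_
  constructor
  · intro H g
    obtain ⟨φ, hφ⟩ := BalancedTensor.exists_character R g
    obtain ⟨ψ, hψ⟩ := H φ
    refine ⟨BalancedTensor.curry ψ, LinearMap.ext fun x => RightCharacterModule.ext fun c => ?_⟩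
    exact (hψ (BalancedTensor.tmul R S C c x)).trans (hφ c x)
  · intro H φ
    obtain ⟨h, hh⟩ := H (BalancedTensor.curry φ)
    obtain ⟨ψ, hψ⟩ := BalancedTensor.exists_character R h
    refine ⟨ψ, DFunLike.congr_fun (f := ψ.comp (BalancedTensor.map R S C f).toAddMonoidHom)
      (BalancedTensor.addHom_ext fun c x => ?_)⟩
    change ψ (BalancedTensor.tmul R S C c (f x)) = _
    rw [hψ, ← BalancedTensor.curry_apply, ← hh]
    rfl

/-- The adjoint form of the character test for exactness. Applied to a projective resolution, the
right side says that every cocycle with values in C⁺ is a coboundary. -/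
theorem BalancedTensor.map_exact_iff (f : N →ₗ[S] N') (g : N' →ₗ[S] N'')
    (hfg : ∀ x, g (f x) = 0) :
    Function.Exact (BalancedTensor.map R S C f) (BalancedTensor.map R S C g) ↔
      ∀ p : N' →ₗ[S] RightCharacterModule S C, p ∘ₗ f = 0 →
        ∃ q : N'' →ₗ[S] RightCharacterModule S C, q ∘ₗ g = p := by
  refine (exact_iff_forall_character (BalancedTensor.map R S C f).toAddMonoidHom
    (BalancedTensor.map R S C g).toAddMonoidHom ?_).trans ?_
  · intro t
    change BalancedTensor.map R S C g (BalancedTensor.map R S C f t) = 0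
    induction t using BalancedTensor.induction with
    | tmul c x => rw [map_tmul, map_tmul, hfg, BalancedTensor.tmul_zero]
    | add y z hy hz => rw [map_add, map_add, hy, hz, add_zero]
  constructor
  · intro H p hp
    obtain ⟨φ, hφ⟩ := BalancedTensor.exists_character R p
    obtain ⟨ψ, hψ⟩ := H φ (DFunLike.congr_fun
      (f := φ.comp (BalancedTensor.map R S C f).toAddMonoidHom) (g := 0)
      (BalancedTensor.addHom_ext fun c x =>
        (hφ c (f x)).trans (DFunLike.congr_fun (DFunLike.congr_fun hp x) c)))
    refine ⟨BalancedTensor.curry ψ, LinearMap.ext fun x => RightCharacterModule.ext fun c => ?_⟩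
    exact (hψ (BalancedTensor.tmul R S C c x)).trans (hφ c x)
  · intro H φ hφ
    obtain ⟨h, hh⟩ := H (BalancedTensor.curry φ)
      (LinearMap.ext fun x => RightCharacterModule.ext fun c =>
        hφ (BalancedTensor.tmul R S C c x))
    obtain ⟨ψ, hψ⟩ := BalancedTensor.exists_character R h
    refine ⟨ψ, DFunLike.congr_fun (f := ψ.comp (BalancedTensor.map R S C g).toAddMonoidHom)
      (BalancedTensor.addHom_ext fun c x => ?_)⟩
    change ψ (BalancedTensor.tmul R S C c (g x)) = _
    rw [hψ, ← BalancedTensor.curry_apply, ← hh]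
    rfl

theorem BalancedTensor.map_surjective (g : N →ₗ[S] N') (hg : Function.Surjective g) :
    Function.Surjective (BalancedTensor.map R S C g) := by
  intro t
  induction t using BalancedTensor.induction with
  | tmul c x =>
    obtain ⟨y, rfl⟩ := hg x
    exact ⟨BalancedTensor.tmul R S C c y, rfl⟩
  | add y z hy hz =>
    obtain ⟨y, rfl⟩ := hy
    obtain ⟨z, rfl⟩ := hz
    exact ⟨y + z, map_add _ _ _⟩

theorem BalancedTensor.map_exact (f : N →ₗ[S] N') (g : N' →ₗ[S] N'')
    (hfg : Function.Exact f g) (hg : Function.Surjective g) :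
    Function.Exact (BalancedTensor.map R S C f) (BalancedTensor.map R S C g) := by
  rw [BalancedTensor.map_exact_iff f g hfg.apply_apply_eq_zero]
  intro p hp
  have hker : LinearMap.ker g ≤ LinearMap.ker p := by
    intro x hx
    obtain ⟨y, rfl⟩ := (hfg x).1 hx
    exact LinearMap.congr_fun hp y
  refine ⟨(LinearMap.ker g).liftQ p hker ∘ₗ (g.quotKerEquivOfSurjective hg).symm.toLinearMap,
    LinearMap.ext fun x => ?_⟩
  have : (g.quotKerEquivOfSurjective hg).symm (g x) = (LinearMap.ker g).mkQ x := by
    rw [LinearEquiv.symm_apply_eq]; rfl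
  simp [this]

end Tensor

/-! ### Pieces of the long exact Ext sequences, as vanishing and lifting statements. -/

section ExtSequences

open Abelian

variable {A : Type u} [Ring A] {L M N : Type u} [AddCommGroup L] [Module A L]
  [AddCommGroup M] [Module A M] [AddCommGroup N] [Module A N]
  {f : L →ₗ[A] M} {g : M →ₗ[A] N}

/-- A short exact sequence of linear maps, as a short complex. -/
abbrev linearShortComplex (f : L →ₗ[A] M) (g : M →ₗ[A] N) (hfg : Function.Exact f g) :
    ShortComplex (ModuleCat.{u} A) :=
  ShortComplex.mk (ModuleCat.ofHom f) (ModuleCat.ofHom g)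
    (ModuleCat.hom_ext hfg.linearMap_comp_eq_zero)

theorem linearShortComplex_shortExact (hf : Function.Injective f) (hfg : Function.Exact f g)
    (hg : Function.Surjective g) : (linearShortComplex f g hfg).ShortExact where
  exact := (ShortComplex.ShortExact.moduleCat_exact_iff_function_exact _).2 hfg
  mono_f := (ModuleCat.mono_iff_injective _).2 hf
  epi_g := (ModuleCat.epi_iff_surjective _).2 hg

variable (X : ModuleCat.{u} A)

section Covariant

theorem exists_lift_of_ext_one (hf : Function.Injective f) (hfg : Function.Exact f g)
    (hg : Function.Surjective g) (h : Subsingleton (Ext X (ModuleCat.of A L) 1))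
    (φ : X →ₗ[A] N) : ∃ ψ : X →ₗ[A] M, g ∘ₗ ψ = φ := by
  have hS := linearShortComplex_shortExact hf hfg hg
  obtain ⟨x, hx⟩ := Ext.covariant_sequence_exact₃ X hS
    (Ext.mk₀ (ModuleCat.ofHom φ : X ⟶ ModuleCat.of A N)) (zero_add 1) (h.elim _ _)
  obtain ⟨y, rfl⟩ := (Ext.mk₀_bijective _ _).2 x
  rw [Ext.mk₀_comp_mk₀] at hx
  have := (Ext.mk₀_bijective _ _).1 hx
  exact ⟨y.hom, congrArg ModuleCat.Hom.hom this⟩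

/-- A class in Ext¹(X, L) dies in Ext¹(X, M), so it is the connecting image of a map X → N; that map
lifts to M, hence its connecting image is zero. -/
theorem ext_one_left_of_lifts (hf : Function.Injective f) (hfg : Function.Exact f g)
    (hg : Function.Surjective g) (h : Subsingleton (Ext X (ModuleCat.of A M) 1))
    (hl : ∀ φ : X →ₗ[A] N, ∃ ψ : X →ₗ[A] M, g ∘ₗ ψ = φ) :
    Subsingleton (Ext X (ModuleCat.of A L) 1) := by
  have hS := linearShortComplex_shortExact hf hfg hg
  refine subsingleton_of_forall_eq 0 fun x => ?_
  obtain ⟨y, rfl⟩ := Ext.covariant_sequence_exact₁ X hS x (h.elim _ _) (zero_add 1)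
  obtain ⟨y, rfl⟩ := (Ext.mk₀_bijective _ _).2 y
  obtain ⟨ψ, hψ⟩ := hl y.hom
  have : y = ModuleCat.ofHom ψ ≫ (linearShortComplex f g hfg).g := ModuleCat.hom_ext hψ.symm
  rw [this, ← Ext.mk₀_comp_mk₀, Ext.comp_assoc_of_second_deg_zero,
    ShortComplex.ShortExact.comp_extClass, Ext.comp_zero]

theorem ext_middle (hf : Function.Injective f) (hfg : Function.Exact f g)
    (hg : Function.Surjective g) {n : ℕ} (h₁ : Subsingleton (Ext X (ModuleCat.of A L) n))
    (h₃ : Subsingleton (Ext X (ModuleCat.of A N) n)) :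
    Subsingleton (Ext X (ModuleCat.of A M) n) := by
  have hS := linearShortComplex_shortExact hf hfg hg
  refine subsingleton_of_forall_eq 0 fun x => ?_
  obtain ⟨y, rfl⟩ := Ext.covariant_sequence_exact₂ X hS x (h₃.elim _ _)
  rw [h₁.elim y 0, Ext.zero_comp]

theorem ext_right (hf : Function.Injective f) (hfg : Function.Exact f g)
    (hg : Function.Surjective g) {n : ℕ} (h₂ : Subsingleton (Ext X (ModuleCat.of A M) n))
    (h₁ : Subsingleton (Ext X (ModuleCat.of A L) (n + 1))) :
    Subsingleton (Ext X (ModuleCat.of A N) n) := by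
  have hS := linearShortComplex_shortExact hf hfg hg
  refine subsingleton_of_forall_eq 0 fun x => ?_
  obtain ⟨y, rfl⟩ := Ext.covariant_sequence_exact₃ X hS x rfl (h₁.elim _ _)
  rw [h₂.elim y 0, Ext.zero_comp]

theorem ext_left (hf : Function.Injective f) (hfg : Function.Exact f g)
    (hg : Function.Surjective g) {n : ℕ} (h₃ : Subsingleton (Ext X (ModuleCat.of A N) n))
    (h₂ : Subsingleton (Ext X (ModuleCat.of A M) (n + 1))) :
    Subsingleton (Ext X (ModuleCat.of A L) (n + 1)) := by
  have hS := linearShortComplex_shortExact hf hfg hg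
  refine subsingleton_of_forall_eq 0 fun x => ?_
  obtain ⟨y, rfl⟩ := Ext.covariant_sequence_exact₁ X hS x (h₂.elim _ _) rfl
  rw [h₃.elim y 0, Ext.zero_comp]

end Covariant

section Contravariant

theorem exists_extension_of_ext_one (hf : Function.Injective f) (hfg : Function.Exact f g)
    (hg : Function.Surjective g) (h : Subsingleton (Ext (ModuleCat.of A N) X 1))
    (φ : L →ₗ[A] X) : ∃ ψ : M →ₗ[A] X, ψ ∘ₗ f = φ := by
  have hS := linearShortComplex_shortExact hf hfg hg
  obtain ⟨x, hx⟩ := Ext.contravariant_sequence_exact₁ hS X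
    (Ext.mk₀ (ModuleCat.ofHom φ : ModuleCat.of A L ⟶ X)) (add_zero 1) (h.elim _ _)
  obtain ⟨y, rfl⟩ := (Ext.mk₀_bijective _ _).2 x
  rw [Ext.mk₀_comp_mk₀] at hx
  have := (Ext.mk₀_bijective _ _).1 hx
  exact ⟨y.hom, congrArg ModuleCat.Hom.hom this⟩

theorem ext_one_right_of_extensions (hf : Function.Injective f) (hfg : Function.Exact f g)
    (hg : Function.Surjective g) (h : Subsingleton (Ext (ModuleCat.of A M) X 1))
    (hl : ∀ φ : L →ₗ[A] X, ∃ ψ : M →ₗ[A] X, ψ ∘ₗ f = φ) :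
    Subsingleton (Ext (ModuleCat.of A N) X 1) := by
  have hS := linearShortComplex_shortExact hf hfg hg
  refine subsingleton_of_forall_eq 0 fun x => ?_
  obtain ⟨y, rfl⟩ := Ext.contravariant_sequence_exact₃ hS X x (h.elim _ _) (add_zero 1)
  obtain ⟨y, rfl⟩ := (Ext.mk₀_bijective _ _).2 y
  obtain ⟨ψ, hψ⟩ := hl y.hom
  have : y = (linearShortComplex f g hfg).f ≫ ModuleCat.ofHom ψ := ModuleCat.hom_ext hψ.symm
  rw [this, ← Ext.mk₀_comp_mk₀, ShortComplex.ShortExact.extClass_comp_assoc]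

theorem ext_middle' (hf : Function.Injective f) (hfg : Function.Exact f g)
    (hg : Function.Surjective g) {n : ℕ} (h₁ : Subsingleton (Ext (ModuleCat.of A L) X n))
    (h₃ : Subsingleton (Ext (ModuleCat.of A N) X n)) :
    Subsingleton (Ext (ModuleCat.of A M) X n) := by
  have hS := linearShortComplex_shortExact hf hfg hg
  refine subsingleton_of_forall_eq 0 fun x => ?_
  obtain ⟨y, rfl⟩ := Ext.contravariant_sequence_exact₂ hS X x (h₁.elim _ _)
  rw [h₃.elim y 0, Ext.comp_zero]

theorem ext_left' (hf : Function.Injective f) (hfg : Function.Exact f g)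
    (hg : Function.Surjective g) {n : ℕ} (h₂ : Subsingleton (Ext (ModuleCat.of A M) X n))
    (h₃ : Subsingleton (Ext (ModuleCat.of A N) X (n + 1))) :
    Subsingleton (Ext (ModuleCat.of A L) X n) := by
  have hS := linearShortComplex_shortExact hf hfg hg
  refine subsingleton_of_forall_eq 0 fun x => ?_
  obtain ⟨y, rfl⟩ := Ext.contravariant_sequence_exact₁ hS X x (add_comm 1 n) (h₃.elim _ _)
  rw [h₂.elim y 0, Ext.comp_zero]

theorem ext_right' (hf : Function.Injective f) (hfg : Function.Exact f g)
    (hg : Function.Surjective g) {n : ℕ} (h₁ : Subsingleton (Ext (ModuleCat.of A L) X n))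
    (h₂ : Subsingleton (Ext (ModuleCat.of A M) X (n + 1))) :
    Subsingleton (Ext (ModuleCat.of A N) X (n + 1)) := by
  have hS := linearShortComplex_shortExact hf hfg hg
  refine subsingleton_of_forall_eq 0 fun x => ?_
  obtain ⟨y, rfl⟩ := Ext.contravariant_sequence_exact₃ hS X x (h₂.elim _ _) (add_comm 1 n)
  rw [h₁.elim y 0, Ext.comp_zero]

end Contravariant

end ExtSequences

/-! ### Tor(C, -) detected by Ext(-, C⁺). -/

section TorDetection

variable (R S : Type u) [Ring R] [Ring S]
variable (C : Type u) [AddCommGroup C] [Module R C] [Module Sᵐᵒᵖ C] [SMulCommClass R Sᵐᵒᵖ C]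

/-- `Tor` vanishing is detected by `Ext` into the character module of `C`. -/
theorem tor_subsingleton_iff (N : ModuleCat.{u} S) (i : ℕ) :
    Subsingleton (tor R S C (i + 1) N) ↔
      Subsingleton (Abelian.Ext N (ModuleCat.of S (RightCharacterModule S C)) (i + 1)) := by
  -- One projective resolution computes both sides, so exactness of C ⊗ P in degree i + 1 is
  -- compared with exactness of Hom_S(P, C⁺) there.
  let P := projectiveResolution N
  have h1 : Subsingleton (tor R S C (i + 1) N) ↔
      Function.Exact (BalancedTensor.map R S C (P.complex.d (i + 2) (i + 1)).hom)
        (BalancedTensor.map R S C (P.complex.d (i + 1) i).hom) := by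
    rw [tor, ← ModuleCat.isZero_iff_subsingleton,
      (P.isoLeftDerivedObj (tensorFunctor R S C) (i + 1)).isZero_iff]
    refine (HomologicalComplex.exactAt_iff_isZero_homology
      (((tensorFunctor R S C).mapHomologicalComplex _).obj P.complex) (i + 1)).symm.trans ?_
    rw [HomologicalComplex.exactAt_iff' _ (i + 2) (i + 1) i (by simp) (by simp),
      ShortComplex.ShortExact.moduleCat_exact_iff_function_exact]
    rfl
  rw [h1, BalancedTensor.map_exact_iff]
  · constructor
    · intro H
      refine subsingleton_of_forall_eq 0 fun x => ?_
      obtain ⟨f, hf, rfl⟩ := P.extMk_surjective x (i + 2) rfl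
      rw [P.extMk_eq_zero_iff f (i + 2) rfl hf i rfl]
      obtain ⟨q, hq⟩ := H f.hom (congrArg ModuleCat.Hom.hom hf)
      exact ⟨ModuleCat.ofHom q, ModuleCat.hom_ext hq⟩
    · intro H p hp
      have hp' : P.complex.d (i + 2) (i + 1) ≫
          (ModuleCat.ofHom p : _ ⟶ ModuleCat.of S (RightCharacterModule S C)) = 0 :=
        ModuleCat.hom_ext hp
      obtain ⟨q, hq⟩ := (P.extMk_eq_zero_iff _ (i + 2) rfl hp' i rfl).1 (H.elim _ _)
      exact ⟨q.hom, congrArg ModuleCat.Hom.hom hq⟩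
  · intro x
    rw [← ModuleCat.comp_apply, P.complex.d_comp_d]
    rfl

-- The working form of membership: Tor is traded for Ext, and degrees i ≥ 1 are written i + 1 to fit
-- the connecting maps.
variable {R S C} in
theorem inAuslanderClass_iff (N : ModuleCat.{u} S) : InAuslanderClass R S C N ↔
    (∀ i : ℕ, Subsingleton
      (Abelian.Ext N (ModuleCat.of S (RightCharacterModule S C)) (i + 1))) ∧
    (∀ i : ℕ, Subsingleton
      (Abelian.Ext (ModuleCat.of R C) (ModuleCat.of R (BalancedTensor R S C N)) (i + 1))) ∧
    Function.Bijective (valuation R S C N) := by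
  constructor
  · intro h
    exact ⟨fun i => (tor_subsingleton_iff R S C N i).1 (h.tor_eq_zero (i + 1) (by omega)),
      fun i => h.ext_eq_zero (i + 1) (by omega), h.bijective_valuation⟩
  · rintro ⟨h1, h2, h3⟩
    refine ⟨fun i hi => ?_, fun i hi => ?_, h3⟩
    · obtain ⟨i, rfl⟩ := Nat.exists_eq_add_of_le' hi
      exact (tor_subsingleton_iff R S C N i).2 (h1 i)
    · obtain ⟨i, rfl⟩ := Nat.exists_eq_add_of_le' hi
      exact h2 i

end TorDetection

/-! ### Short five lemmas with one-sided hypotheses. -/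

section ShortFive

variable {A : Type*} [Ring A] {L M N L' M' N' : Type*} [AddCommGroup L] [Module A L]
  [AddCommGroup M] [Module A M] [AddCommGroup N] [Module A N] [AddCommGroup L'] [Module A L']
  [AddCommGroup M'] [Module A M'] [AddCommGroup N'] [Module A N']
  {f : L →ₗ[A] M} {g : M →ₗ[A] N} {f' : L' →ₗ[A] M'} {g' : M' →ₗ[A] N'}
  {α : L →ₗ[A] L'} {β : M →ₗ[A] M'} {γ : N →ₗ[A] N'}

theorem bijective_middle (hfg : Function.Exact f g) (hg : Function.Surjective g)
    (hf' : Function.Injective f') (hfg' : Function.Exact f' g')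
    (h₁ : ∀ x, f' (α x) = β (f x)) (h₂ : ∀ x, g' (β x) = γ (g x))
    (hα : Function.Bijective α) (hγ : Function.Bijective γ) : Function.Bijective β := by
  constructor
  · rw [injective_iff_map_eq_zero]
    intro x hx
    have : g x = 0 := hγ.1 (by rw [← h₂, hx, map_zero, map_zero])
    obtain ⟨y, rfl⟩ := (hfg x).1 this
    have hy : y = 0 := hα.1 (hf' (by rw [h₁, hx, map_zero, map_zero]))
    rw [hy, map_zero]
  · intro y
    obtain ⟨z, hz⟩ := hγ.2 (g' y)
    obtain ⟨x, rfl⟩ := hg z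
    have : g' (y - β x) = 0 := by rw [map_sub, h₂, hz, sub_self]
    obtain ⟨w, hw⟩ := (hfg' _).1 this
    obtain ⟨v, rfl⟩ := hα.2 w
    exact ⟨x + f v, by rw [map_add, ← h₁, hw, add_sub_cancel]⟩

theorem bijective_left (hf : Function.Injective f) (hfg : Function.Exact f g)
    (hf' : Function.Injective f') (hfg' : Function.Exact f' g')
    (h₁ : ∀ x, f' (α x) = β (f x)) (h₂ : ∀ x, g' (β x) = γ (g x))
    (hβ : Function.Bijective β) (hγ : Function.Injective γ) : Function.Bijective α := by
  constructor
  · intro x y hxy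
    exact hf (hβ.1 (by rw [← h₁, ← h₁, hxy]))
  · intro y
    obtain ⟨x, hx⟩ := hβ.2 (f' y)
    have : g x = 0 := hγ (by rw [← h₂, hx, hfg'.apply_apply_eq_zero, map_zero])
    obtain ⟨w, rfl⟩ := (hfg x).1 this
    exact ⟨w, hf' (by rw [h₁, hx])⟩

theorem bijective_right (hfg : Function.Exact f g) (hg : Function.Surjective g)
    (hfg' : Function.Exact f' g') (hg' : Function.Surjective g')
    (h₁ : ∀ x, f' (α x) = β (f x)) (h₂ : ∀ x, g' (β x) = γ (g x))
    (hα : Function.Surjective α) (hβ : Function.Bijective β) : Function.Bijective γ := by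
  constructor
  · rw [injective_iff_map_eq_zero]
    intro z hz
    obtain ⟨x, rfl⟩ := hg z
    rw [← h₂] at hz
    obtain ⟨w, hw⟩ := (hfg' _).1 hz
    obtain ⟨v, rfl⟩ := hα w
    rw [h₁] at hw
    rw [← hβ.1 hw, hfg.apply_apply_eq_zero]
  · intro z
    obtain ⟨y, rfl⟩ := hg' z
    obtain ⟨x, rfl⟩ := hβ.2 y
    exact ⟨g x, (h₂ x).symm⟩

end ShortFive

/-! ### Closure of the Auslander class in short exact sequences. -/

section TwoOfThree

variable {R S : Type u} [Ring R] [Ring S]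
variable {C : Type u} [AddCommGroup C] [Module R C] [Module Sᵐᵒᵖ C] [SMulCommClass R Sᵐᵒᵖ C]

/-- Functoriality of `Hom_R(C, -)`. -/
def HomModule.map {M M' : Type u} [AddCommGroup M] [Module R M] [AddCommGroup M'] [Module R M']
    (f : M →ₗ[R] M') : HomModule R C M →ₗ[S] HomModule R C M' where
  toFun φ := f ∘ₗ (show C →ₗ[R] M from φ)
  map_add' _ _ := LinearMap.comp_add _ _ f
  map_smul' _ _ := rfl

theorem HomModule.map_injective {M M' : Type u} [AddCommGroup M] [Module R M] [AddCommGroup M']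
    [Module R M'] (f : M →ₗ[R] M') (hf : Function.Injective f) :
    Function.Injective (HomModule.map (S := S) (C := C) f) := fun _ _ h =>
  LinearMap.ext fun c => hf (LinearMap.congr_fun (f := (show C →ₗ[R] M' from _)) h c)

theorem HomModule.map_exact {M M' M'' : Type u} [AddCommGroup M] [Module R M] [AddCommGroup M']
    [Module R M'] [AddCommGroup M''] [Module R M''] (f : M →ₗ[R] M') (g : M' →ₗ[R] M'')
    (hf : Function.Injective f) (hfg : Function.Exact f g) :
    Function.Exact (HomModule.map (S := S) (C := C) f) (HomModule.map (S := S) (C := C) g) := by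
  intro φ
  constructor
  · intro h
    have hr : ∀ c, (show C →ₗ[R] M' from φ) c ∈ LinearMap.range f := fun c =>
      (hfg _).1 (LinearMap.congr_fun (f := (show C →ₗ[R] M'' from _)) h c)
    refine ⟨(LinearEquiv.ofInjective f hf).symm.toLinearMap ∘ₗ
      LinearMap.codRestrict (LinearMap.range f) (show C →ₗ[R] M' from φ) hr,
      LinearMap.ext fun c => ?_⟩
    exact congrArg Subtype.val ((LinearEquiv.ofInjective f hf).apply_symm_apply ⟨_, hr c⟩)
  · rintro ⟨ψ, rfl⟩
    exact LinearMap.ext fun c => hfg.apply_apply_eq_zero _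

theorem valuation_naturality {N N' : Type u} [AddCommGroup N] [Module S N] [AddCommGroup N']
    [Module S N'] (f : N →ₗ[S] N') (x : N) :
    HomModule.map (S := S) (C := C) (BalancedTensor.map R S C f) (valuation R S C N x) =
      valuation R S C N' (f x) := rfl

variable {L M N : ModuleCat.{u} S} {f : L →ₗ[S] M} {g : M →ₗ[S] N}

/-- This is the use of Tor_1(C, N) = 0, in the form Ext¹(N, C⁺) = 0: maps L → C⁺ extend to M. -/
theorem map_injective_of_inAuslanderClass (hf : Function.Injective f) (hfg : Function.Exact f g)
    (hg : Function.Surjective g) (hN : InAuslanderClass R S C N) :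
    Function.Injective (BalancedTensor.map R S C f) :=
  (BalancedTensor.map_injective_iff f).2 (exists_extension_of_ext_one
    (ModuleCat.of S (RightCharacterModule S C)) hf hfg hg (((inAuslanderClass_iff N).1 hN).1 0))

theorem InAuslanderClass.extension (hf : Function.Injective f) (hfg : Function.Exact f g)
    (hg : Function.Surjective g) (hL : InAuslanderClass R S C L) (hN : InAuslanderClass R S C N) :
    InAuslanderClass R S C M := by
  have hTf := map_injective_of_inAuslanderClass hf hfg hg hN
  have hTfg := BalancedTensor.map_exact (R := R) (C := C) f g hfg hg
  have hTg := BalancedTensor.map_surjective (R := R) (C := C) g hg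
  obtain ⟨l1, l2, l3⟩ := (inAuslanderClass_iff L).1 hL
  obtain ⟨n1, n2, n3⟩ := (inAuslanderClass_iff N).1 hN
  refine (inAuslanderClass_iff M).2 ⟨fun i => ext_middle' _ hf hfg hg (l1 i) (n1 i),
    fun i => ext_middle _ hTf hTfg hTg (l2 i) (n2 i), ?_⟩
  exact bijective_middle hfg hg (HomModule.map_injective _ hTf)
    (HomModule.map_exact _ _ hTf hTfg) (valuation_naturality f) (valuation_naturality g) l3 n3

theorem InAuslanderClass.kernel (hf : Function.Injective f) (hfg : Function.Exact f g)
    (hg : Function.Surjective g) (hM : InAuslanderClass R S C M) (hN : InAuslanderClass R S C N) :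
    InAuslanderClass R S C L := by
  have hTf := map_injective_of_inAuslanderClass hf hfg hg hN
  have hTfg := BalancedTensor.map_exact (R := R) (C := C) f g hfg hg
  have hTg := BalancedTensor.map_surjective (R := R) (C := C) g hg
  obtain ⟨m1, m2, m3⟩ := (inAuslanderClass_iff M).1 hM
  obtain ⟨n1, n2, n3⟩ := (inAuslanderClass_iff N).1 hN
  refine (inAuslanderClass_iff L).2 ⟨fun i => ext_left' _ hf hfg hg (m1 i) (n1 (i + 1)),
    fun i => ?_, ?_⟩
  · cases i with
    | zero =>
      -- In degree 1 every map C → C ⊗ N must lift to C ⊗ M. Surjectivity of μ_N writes it as c ↦ c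
      -- ⊗ z, and a preimage of z in M gives the lift.
      refine ext_one_left_of_lifts _ hTf hTfg hTg (m2 0) fun φ => ?_
      obtain ⟨z, hz⟩ := n3.2 φ
      obtain ⟨x, rfl⟩ := hg z
      exact ⟨valuation R S C M x, hz⟩
    | succ i => exact ext_left _ hTf hTfg hTg (n2 i) (m2 (i + 1))
  · exact bijective_left hf hfg (HomModule.map_injective _ hTf)
      (HomModule.map_exact _ _ hTf hTfg) (valuation_naturality f) (valuation_naturality g) m3 n3.1

/-- Injectivity of C ⊗ f has to be assumed: given that M is in the class, it amounts to Tor_1(C, N)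
= 0, which does not follow from L and M alone. -/
theorem InAuslanderClass.cokernel (hf : Function.Injective f) (hfg : Function.Exact f g)
    (hg : Function.Surjective g) (hL : InAuslanderClass R S C L) (hM : InAuslanderClass R S C M)
    (hTf : Function.Injective (BalancedTensor.map R S C f)) :
    InAuslanderClass R S C N := by
  have hTfg := BalancedTensor.map_exact (R := R) (C := C) f g hfg hg
  have hTg := BalancedTensor.map_surjective (R := R) (C := C) g hg
  obtain ⟨l1, l2, l3⟩ := (inAuslanderClass_iff L).1 hL
  obtain ⟨m1, m2, m3⟩ := (inAuslanderClass_iff M).1 hM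
  refine (inAuslanderClass_iff N).2 ⟨fun i => ?_,
    fun i => ext_right _ hTf hTfg hTg (m2 i) (l2 (i + 1)), ?_⟩
  · cases i with
    | zero =>
      exact ext_one_right_of_extensions _ hf hfg hg (m1 0)
        ((BalancedTensor.map_injective_iff f).1 hTf)
    | succ i => exact ext_right' _ hf hfg hg (l1 i) (m1 (i + 1))
  · exact bijective_right hfg hg (HomModule.map_exact _ _ hTf hTfg)
      (fun φ => exists_lift_of_ext_one _ hTf hTfg hTg (l2 0) φ)
      (valuation_naturality f) (valuation_naturality g) l3.2 m3

end TwoOfThree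

/-! ### Factoring maps into injectives through maps with smaller kernel. -/

section Factorization

theorem exists_factor_of_injective {A : Type u} [Ring A] {X Y I : Type u} [AddCommGroup X]
    [Module A X] [AddCommGroup Y] [Module A Y] [AddCommGroup I] [Module A I] [Module.Injective A I]
    (f : X →ₗ[A] Y) (g : X →ₗ[A] I) (h : LinearMap.ker f ≤ LinearMap.ker g) :
    ∃ e : Y →ₗ[A] I, ∀ x, e (f x) = g x := by
  obtain ⟨e, he⟩ := Module.Injective.out ((LinearMap.ker f).liftQ f le_rfl)
    (LinearMap.ker_eq_bot.1 (Submodule.ker_liftQ_eq_bot _ _ _ le_rfl))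
    ((LinearMap.ker f).liftQ g h)
  exact ⟨e, fun x => he ((LinearMap.ker f).mkQ x)⟩

theorem exists_character_factor {X Y : Type*} [AddCommGroup X] [AddCommGroup Y] (f : X →+ Y)
    (g : X →+ AddCircle (1 : ℚ)) (h : ∀ x, f x = 0 → g x = 0) :
    ∃ e : Y →+ AddCircle (1 : ℚ), ∀ x, e (f x) = g x :=
  (exact_iff_forall_character f.ker.subtype f fun x => x.2).1
    (fun x => ⟨fun hx => ⟨⟨x, hx⟩, rfl⟩, by rintro ⟨y, rfl⟩; exact y.2⟩) g fun x => h x x.2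

end Factorization

/-! ### Finite presentations and finitely generated syzygies. -/

section Presentations

variable {A : Type u} [Ring A]

/-- Generators and relations of a finitely presented module. -/
theorem exists_generators_relations (M : Type u) [AddCommGroup M] [Module A M]
    [Module.FinitePresentation A M] :
    ∃ (m l : ℕ) (e : Fin m → M) (s : Fin l → Fin m → A),
      (∀ x : M, ∃ t : Fin m → A, ∑ a, t a • e a = x) ∧ (∀ b, ∑ a, s b a • e a = 0) ∧
      ∀ (X : Type u) [AddCommGroup X] [Module A X] (c : Fin m → X),
        (∀ b, ∑ a, s b a • c a = 0) → ∃ g : M →ₗ[A] X, ∀ a, g (e a) = c a := by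
  obtain ⟨m, π, hπ⟩ := Module.Finite.exists_fin' A M
  obtain ⟨l, s, hs⟩ := Submodule.fg_iff_exists_fin_generating_family.1
    (Module.FinitePresentation.fg_ker π hπ)
  have hsum : ∀ {X : Type u} [AddCommGroup X] [Module A X] (g : (Fin m → A) →ₗ[A] X)
      (t : Fin m → A), g t = ∑ a, t a • g (Pi.single a 1) := fun g t => by
    conv_lhs => rw [pi_eq_sum_univ' t]
    simp [map_sum]
  refine ⟨m, l, fun a => π (Pi.single a 1), s, fun x => ?_, fun b => ?_, fun X _ _ c hc => ?_⟩
  · obtain ⟨t, rfl⟩ := hπ x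
    exact ⟨t, (hsum π t).symm⟩
  · rw [← hsum π]
    exact LinearMap.mem_ker.1 (hs ▸ Submodule.subset_span ⟨b, rfl⟩)
  · have hker : LinearMap.ker π ≤ LinearMap.ker (Fintype.linearCombination A c) := by
      rw [← hs, Submodule.span_le]
      rintro _ ⟨b, rfl⟩
      exact hc b
    have hq : ∀ t, (π.quotKerEquivOfSurjective hπ).symm (π t) = (LinearMap.ker π).mkQ t :=
      fun t => by rw [LinearEquiv.symm_apply_eq]; rfl
    refine ⟨(LinearMap.ker π).liftQ _ hker ∘ₗ (π.quotKerEquivOfSurjective hπ).symm.toLinearMap,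
      fun a => ?_⟩
    simp [hq, Fintype.linearCombination_apply_single]

/-- There is a partial resolution of length `n` by finitely generated projective modules, with a
finitely generated last syzygy. -/
def HasFiniteSyzygies : ℕ → ∀ (M : Type u) [AddCommGroup M] [Module A M], Prop
  | 0, M, _, _ => Module.Finite A M
  | n + 1, M, _, _ => ∃ (P K : ModuleCat.{u} A) (j : K →ₗ[A] P) (p : P →ₗ[A] M),
      Module.Finite A P ∧ Module.Projective A P ∧ Function.Injective j ∧ Function.Exact j p ∧
      Function.Surjective p ∧ HasFiniteSyzygies n K

theorem HasFiniteSyzygies.finite {n : ℕ} {M : Type u} [AddCommGroup M] [Module A M]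
    (h : HasFiniteSyzygies (A := A) n M) : Module.Finite A M := by
  cases n with
  | zero => exact h
  | succ n =>
    obtain ⟨P, K, j, p, hP, -, -, -, hp, -⟩ := h
    exact Module.Finite.of_surjective p hp

theorem HasFiniteSyzygies.finitePresentation {n : ℕ} {M : Type u} [AddCommGroup M] [Module A M]
    (h : HasFiniteSyzygies (A := A) (n + 1) M) : Module.FinitePresentation A M := by
  obtain ⟨P, K, j, p, hP, hP', hj, hjp, hp, hK⟩ := h
  have := hK.finite
  have := Module.finitePresentation_of_projective A P
  refine Module.finitePresentation_of_surjective p hp ?_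
  rw [LinearMap.exact_iff.1 hjp, LinearMap.range_eq_map]
  exact Module.Finite.fg_top.map j

theorem HasDegreewiseFiniteProjectiveResolution.hasFiniteSyzygies {M : ModuleCat.{u} A}
    (h : HasDegreewiseFiniteProjectiveResolution M) (n : ℕ) :
    HasFiniteSyzygies (A := A) n M := by
  obtain ⟨P, hP⟩ := h
  have hproj : ∀ i, Module.Projective A (P.complex.X i) := fun i =>
    (IsProjective.iff_projective _).2 (P.projective i)
  have hex : ∀ i, Function.Exact (P.complex.d (i + 2) (i + 1)).hom
      (P.complex.d (i + 1) i).hom := fun i =>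
    (ShortComplex.ShortExact.moduleCat_exact_iff_function_exact _).1
      ((HomologicalComplex.exactAt_iff' _ (i + 2) (i + 1) i (by simp) (by simp)).1
        (P.complex_exactAt_succ i))
  have hex₀ : Function.Exact (P.complex.d 1 0).hom (P.π.f 0).hom :=
    (ShortComplex.ShortExact.moduleCat_exact_iff_function_exact _).1 P.exact₀
  have hsurj : Function.Surjective (P.π.f 0).hom :=
    (ModuleCat.epi_iff_surjective _).1 inferInstance
  -- The syzygies are the images of the differentials; the claim is for all i at once because each
  -- step moves to the next differential.
  have hrange : ∀ (n i : ℕ), HasFiniteSyzygies (A := A) n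
      (LinearMap.range (P.complex.d (i + 1) i).hom) := by
    intro n
    induction n with
    | zero => exact fun i => Module.Finite.range _
    | succ n ih =>
      intro i
      refine ⟨P.complex.X (i + 1), ModuleCat.of A (LinearMap.range (P.complex.d (i + 2) (i + 1)).hom),
        Submodule.subtype _, LinearMap.rangeRestrict _, hP _, hproj _, Subtype.val_injective, ?_,
        LinearMap.surjective_rangeRestrict _, ih (i + 1)⟩
      intro x
      rw [LinearMap.rangeRestrict, ← Subtype.coe_inj]
      refine (hex i x).trans ?_
      simp
  cases n with
  | zero => exact Module.Finite.of_surjective (P.π.f 0).hom hsurj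
  | succ n =>
    refine ⟨P.complex.X 0, ModuleCat.of A (LinearMap.range (P.complex.d 1 0).hom),
      Submodule.subtype _, (P.π.f 0).hom, hP 0, hproj 0, Subtype.val_injective, ?_, hsurj,
      hrange n 0⟩
    intro x
    refine (hex₀ x).trans ?_
    simp

end Presentations

/-! ### Injectivity of P⁺ for P finitely generated projective. -/

section CharacterInjective

variable {S : Type u} [Ring S]

/-- A finite dual basis of P reduces a map X → P⁺ to finitely many characters of X. These extend to
Y since ℚ/ℤ is divisible, and the dual basis reassembles the extensions into an S-linear map. -/
theorem RightCharacterModule.injective_of_projective (P : Type u) [AddCommGroup P] [Module Sᵐᵒᵖ P]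
    [Module.Finite Sᵐᵒᵖ P] [Module.Projective Sᵐᵒᵖ P] :
    Injective (ModuleCat.of S (RightCharacterModule S P)) := by
  rw [← Module.injective_iff_injective_object]
  obtain ⟨n, f, g, -, -, hfg⟩ := Module.Finite.exists_comp_eq_id_of_projective Sᵐᵒᵖ P
  have hdual : ∀ p, ∑ a : Fin n, g p a • f (Pi.single a 1) = p := fun p => by
    conv_rhs => rw [← LinearMap.id_apply (R := Sᵐᵒᵖ) p, ← hfg, LinearMap.comp_apply,
      pi_eq_sum_univ' (g p)]
    simp [map_sum]
  refine ⟨fun X Y _ _ _ _ i hi φ => ?_⟩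
  have hext : ∀ a, ∃ β : Y →+ AddCircle (1 : ℚ), ∀ x, β (i x) = φ x (f (Pi.single a 1)) := by
    intro a
    exact (injective_iff_forall_character i.toAddMonoidHom).1 hi
      (AddMonoidHom.mk' (fun x => φ x (f (Pi.single a 1))) fun x y => by simp)
  choose β hβ using hext
  refine ⟨{ toFun := fun y => AddMonoidHom.mk' (fun p => ∑ a, β a ((g p a).unop • y)) ?_
            map_add' := ?_
            map_smul' := ?_ }, fun x => ?_⟩
  · intro p q
    simp [add_smul, Finset.sum_add_distrib]
  · intro y z
    ext p
    change ∑ a, β a ((g p a).unop • (y + z)) =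
      ∑ a, β a ((g p a).unop • y) + ∑ a, β a ((g p a).unop • z)
    simp [Finset.sum_add_distrib]
  · intro s y
    ext p
    change ∑ a, β a ((g p a).unop • s • y) = ∑ a, β a ((g (MulOpposite.op s • p) a).unop • y)
    simp [mul_smul]
  · ext p
    change ∑ a, β a ((g p a).unop • i x) = φ x p
    conv_rhs => rw [← hdual p, map_sum]
    refine Finset.sum_congr rfl fun a _ => ?_
    rw [← map_smul, hβ, map_smul]
    rfl

end CharacterInjective

/-! ### Vanishing of Ext from Hom_R(C, I) into character modules. -/

section HomIntoInjective

variable {R S : Type u} [Ring R] [Ring S]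
variable {C : Type u} [AddCommGroup C] [Module R C] [Module Sᵐᵒᵖ C] [SMulCommClass R Sᵐᵒᵖ C]
variable {I : Type u} [AddCommGroup I] [Module R I]

instance : FunLike (HomModule R C I) C I := inferInstanceAs (FunLike (C →ₗ[R] I) C I)

instance : LinearMapClass (HomModule R C I) R C I :=
  inferInstanceAs (LinearMapClass (C →ₗ[R] I) R C I)

@[ext] theorem HomModule.ext {d d' : HomModule R C I} (h : ∀ c, d c = d' c) : d = d' :=
  DFunLike.ext _ _ h

@[simp] theorem HomModule.add_apply (d d' : HomModule R C I) (c : C) : (d + d') c = d c + d' c :=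
  rfl

@[simp] theorem HomModule.smul_apply (s : S) (d : HomModule R C I) (c : C) :
    (s • d) c = d (MulOpposite.op s • c) := rfl

@[simp] theorem HomModule.sum_apply {ι : Type*} (t : Finset ι) (d : ι → HomModule R C I) (c : C) :
    (∑ a ∈ t, d a) c = ∑ a ∈ t, d a c :=
  LinearMap.sum_apply t (fun a => show C →ₗ[R] I from d a) c

variable [Module.Injective R I]

/-- A family in `Hom_R(C, I)` that pairs to zero with all families `(g e_a)` is a consequence of the
relations between the generators `e_a`. -/
theorem exists_relations_of_pairing_eq_zero {m l : ℕ} (s : Fin l → Fin m → Sᵐᵒᵖ)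
    (d : Fin m → HomModule R C I)
    (hd : ∀ c : Fin m → C, (∀ b, ∑ a, s b a • c a = 0) → ∑ a, d a (c a) = 0) :
    ∃ d' : Fin l → HomModule R C I, ∀ a, d a = ∑ b, (s b a).unop • d' b := by
  -- The relation matrix acts as T : C^m → C^l. The pairing D with d vanishes on ker T, so it
  -- factors as E ∘ T because I is injective; the components of E on C^l are the required d'.
  let T : (Fin m → C) →ₗ[R] (Fin l → C) :=
    { toFun := fun c b => ∑ a, s b a • c a
      map_add' := fun c c' => by ext b; simp [Finset.sum_add_distrib]
      map_smul' := fun r c => by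
        ext b
        simp only [Pi.smul_apply, RingHom.id_apply, Finset.smul_sum]
        exact Finset.sum_congr rfl fun a _ => (smul_comm r (s b a) (c a)).symm }
  let D : (Fin m → C) →ₗ[R] I :=
    { toFun := fun c => ∑ a, d a (c a)
      map_add' := fun c c' => by simp [Finset.sum_add_distrib]
      map_smul' := fun r c => by simp [Finset.smul_sum] }
  obtain ⟨E, hE⟩ := exists_factor_of_injective T D fun c hc => hd c fun b => congrFun hc b
  refine ⟨fun b => (show HomModule R C I from E ∘ₗ LinearMap.single R (fun _ => C) b),
    fun a => HomModule.ext fun c => ?_⟩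
  have h1 : D (Pi.single a c) = d a c := by
    change ∑ a', d a' ((Pi.single a c : Fin m → C) a') = _
    rw [Finset.sum_eq_single a, Pi.single_eq_same]
    · intro b _ hb
      rw [Pi.single_eq_of_ne hb, map_zero]
    · simp
  have h2 : T (Pi.single a c) = ∑ b, Pi.single b (s b a • c) := by
    rw [Finset.univ_sum_single]
    ext b
    change ∑ a', s b a' • (Pi.single a c : Fin m → C) a' = _
    rw [Finset.sum_eq_single a, Pi.single_eq_same]
    · intro b _ hb
      rw [Pi.single_eq_of_ne hb, smul_zero]
    · simp
  rw [← h1, ← hE, h2, map_sum, HomModule.sum_apply]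
  rfl

/-- Let `j : K → P` be a monomorphism of right modules with `K` finitely presented along which maps
to `C` extend. Then maps `Hom_R(C, I) → K⁺` lift along `P⁺ → K⁺`. -/
theorem exists_lift_character {K P : Type u} [AddCommGroup K] [Module Sᵐᵒᵖ K] [AddCommGroup P]
    [Module Sᵐᵒᵖ P] [Module.FinitePresentation Sᵐᵒᵖ K] (j : K →ₗ[Sᵐᵒᵖ] P)
    (hj : ∀ g : K →ₗ[Sᵐᵒᵖ] C, ∃ h : P →ₗ[Sᵐᵒᵖ] C, h ∘ₗ j = g)
    (φ : HomModule R C I →ₗ[S] RightCharacterModule S K) :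
    ∃ ψ : HomModule R C I →ₗ[S] RightCharacterModule S P,
      RightCharacterModule.map j ∘ₗ ψ = φ := by
  obtain ⟨m, l, e, s, hgen, hrel, huniv⟩ := exists_generators_relations (A := Sᵐᵒᵖ) K
  -- A family d stands for the formal tensor ∑ e_a ⊗ d_a over K. Then `Φ₀` is φ viewed as a
  -- character of such tensors, and `Ψ` pairs them with all maps P → C. If `Φ₀` factors through `Ψ`,
  -- it is defined on enough to make sense over P as well.
  let Ψ : (Fin m → HomModule R C I) →+ ((P →ₗ[Sᵐᵒᵖ] C) → I) :=
    AddMonoidHom.mk' (fun d h => ∑ a, d a (h (j (e a))))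
      (fun d d' => by ext h; simp [Finset.sum_add_distrib])
  let Φ₀ : (Fin m → HomModule R C I) →+ AddCircle (1 : ℚ) :=
    AddMonoidHom.mk' (fun d => ∑ a, φ (d a) (e a))
      (fun d d' => by simp [Finset.sum_add_distrib])
  -- A family killed by `Ψ` pairs to zero with every map K → C, since these all extend to P. It is
  -- therefore a consequence of the relations among the e_a, so `Φ₀` kills it.
  obtain ⟨Φ, hΦ⟩ := exists_character_factor Ψ Φ₀ (by
    intro d hd
    obtain ⟨d', hd'⟩ := exists_relations_of_pairing_eq_zero s d (by
      intro c hc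
      obtain ⟨g, hg⟩ := huniv C c hc
      obtain ⟨h, rfl⟩ := hj g
      simp only [← hg]
      exact congrFun hd h)
    change ∑ a, φ (d a) (e a) = 0
    have : ∀ a, φ (d a) (e a) = ∑ b, φ (d' b) (s b a • e a) := by
      intro a
      rw [hd', map_sum]
      have : ∀ t : Finset (Fin l), (∑ b ∈ t, φ ((s b a).unop • d' b)) (e a) =
          ∑ b ∈ t, φ (d' b) (s b a • e a) := by
        intro t
        induction t using Finset.cons_induction with
        | empty => rfl
        | cons b t hb ih =>
          rw [Finset.sum_cons, Finset.sum_cons, RightCharacterModule.add_apply, ih, map_smul]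
          rfl
      exact this _
    simp only [this]
    rw [Finset.sum_comm]
    refine Finset.sum_eq_zero fun b _ => ?_
    rw [← map_sum, hrel, map_zero])
  refine ⟨{ toFun := fun d => AddMonoidHom.mk' (fun p => Φ fun h => d (h p)) ?_
            map_add' := ?_
            map_smul' := ?_ }, ?_⟩
  · intro p q
    rw [← map_add]
    congr 1
    ext h
    simp
  · intro d d'
    ext p
    exact map_add Φ (fun h => d (h p)) (fun h => d' (h p))
  · intro s d
    ext p
    change Φ (fun h => d (MulOpposite.op s • h p)) = Φ fun h => d (h (MulOpposite.op s • p))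
    simp
  · refine LinearMap.ext fun d => RightCharacterModule.ext fun k => ?_
    obtain ⟨t, rfl⟩ := hgen k
    have h1 := hΦ fun a => (t a).unop • d
    have h2 : Φ₀ (fun a => (t a).unop • d) = φ d (∑ a, t a • e a) := by
      rw [map_sum]
      change ∑ a, φ ((t a).unop • d) (e a) = _
      simp
    rw [← h2, ← h1]
    change Φ (fun h => d (h (j (∑ a, t a • e a)))) = _
    congr 1
    ext h
    change _ = ∑ a, ((t a).unop • d) (h (j (e a)))
    simp

/-- `Ext_S^i(Hom_R(C, I), K⁺)` vanishes if `Ext_{S^op}^i(K, C)` does, for `i ≥ 1`. -/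
theorem ext_homModule_character (i : ℕ) : ∀ (K : ModuleCat.{u} Sᵐᵒᵖ),
    HasFiniteSyzygies (A := Sᵐᵒᵖ) (i + 2) K →
    (∀ n : ℕ, Subsingleton (Abelian.Ext K (ModuleCat.of Sᵐᵒᵖ C) (n + 1))) →
    Subsingleton (Abelian.Ext (ModuleCat.of S (HomModule R C I))
      (ModuleCat.of S (RightCharacterModule S K)) (i + 1)) := by
  induction i with
  | zero =>
    -- In 0 → K⁺ → P⁺ → K'⁺ → 0 the middle term is injective, so Ext¹ into K⁺ only obstructs lifting
    -- maps Hom_R(C, I) → K'⁺ to P⁺. The lifting needs K' finitely presented, whence the length i +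
    -- 2.
    rintro K ⟨P, K', j, p, hP, hP', hj, hjp, hp, hK'⟩ hext
    have := hK'.finitePresentation
    have := RightCharacterModule.injective_of_projective (S := S) P
    exact ext_one_left_of_lifts _ (RightCharacterModule.map_injective p hp)
      (RightCharacterModule.map_exact j p hjp) (RightCharacterModule.map_surjective j hj)
      (Abelian.Ext.subsingleton_of_injective _ _ 0)
      (exists_lift_character j (exists_extension_of_ext_one _ hj hjp hp (hext 0)))
  | succ i ih =>
    -- Dimension shifting on both sides: K is replaced by its syzygy K', which inherits Ext(K', C) =
    -- 0 because P is projective.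
    rintro K ⟨P, K', j, p, hP, hP', hj, hjp, hp, hK'⟩ hext
    have := RightCharacterModule.injective_of_projective (S := S) P
    have : Projective (ModuleCat.of Sᵐᵒᵖ P) := (IsProjective.iff_projective _).1 hP'
    exact ext_left _ (RightCharacterModule.map_injective p hp)
      (RightCharacterModule.map_exact j p hjp) (RightCharacterModule.map_surjective j hj)
      (ih K' hK' fun n => ext_left' _ hj hjp hp
        (Abelian.Ext.subsingleton_of_projective _ _ n) (hext (n + 1)))
      (Abelian.Ext.subsingleton_of_injective _ _ (i + 1))

end HomIntoInjective

/-! ### C-injective modules cogenerate the Auslander class. -/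

section CInjective

variable {R S : Type u} [Ring R] [Ring S]
variable {C : Type u} [AddCommGroup C] [Module R C] [Module Sᵐᵒᵖ C] [SMulCommClass R Sᵐᵒᵖ C]

/-- The evaluation map `C ⊗_S Hom_R(C, I) → I`. -/
noncomputable def evaluation (R S C : Type u) [Ring R] [Ring S] [AddCommGroup C] [Module R C]
    [Module Sᵐᵒᵖ C] [SMulCommClass R Sᵐᵒᵖ C] (I : Type u) [AddCommGroup I] [Module R I] :
    BalancedTensor R S C (HomModule R C I) →ₗ[R] I where
  __ := BalancedTensor.lift (R := R) (S := S)
    (AddMonoidHom.mk' (fun c => AddMonoidHom.mk' (fun d : HomModule R C I => d c) fun _ _ => rfl)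
      fun c c' => AddMonoidHom.ext fun d => map_add d c c') fun _ _ _ => rfl
  map_smul' r t := by
    change BalancedTensor.lift _ _ (r • t) = r • BalancedTensor.lift _ _ t
    induction t using BalancedTensor.induction with
    | tmul c d =>
      rw [← BalancedTensor.smul_tmul]
      exact map_smul d r c
    | add y z hy hz => rw [smul_add, map_add, map_add, hy, hz, smul_add]

@[simp] theorem evaluation_tmul {I : Type u} [AddCommGroup I] [Module R I] (c : C)
    (d : HomModule R C I) : evaluation R S C I (BalancedTensor.tmul R S C c d) = d c := rfl

theorem BalancedTensor.exists_sum_tmul {N : Type u} [AddCommGroup N] [Module S N] {m : ℕ}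
    {e : Fin m → C} (he : ∀ c : C, ∃ t : Fin m → Sᵐᵒᵖ, ∑ a, t a • e a = c)
    (t : BalancedTensor R S C N) :
    ∃ d : Fin m → N, t = ∑ a, BalancedTensor.tmul R S C (e a) (d a) := by
  induction t using BalancedTensor.induction with
  | tmul c x =>
    obtain ⟨t, rfl⟩ := he c
    refine ⟨fun a => (t a).unop • x, ?_⟩
    simp only [BalancedTensor.tmul_smul, MulOpposite.op_unop]
    exact map_sum (AddMonoidHom.mk' (fun c => BalancedTensor.tmul R S C c x)
      fun c c' => BalancedTensor.add_tmul c c' x) _ _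
  | add y z hy hz =>
    obtain ⟨d, rfl⟩ := hy
    obtain ⟨d', rfl⟩ := hz
    exact ⟨d + d', by simp [BalancedTensor.tmul_add, Finset.sum_add_distrib]⟩

variable (hC : IsSemidualizing R S C)
include hC

/-- Both halves rest on the homothety R → End(C_S). If ∑ e_a ⊗ d_a evaluates to 0, then d pairs to
zero with (g e_a) for every g in End(C_S), as g is multiplication by some r; so d comes from the
relations and the tensor vanishes. For surjectivity, r ↦ (r e_a) embeds R into C^m, and R → I, 1 ↦
x, extends to C^m. -/
theorem IsSemidualizing.evaluation_bijective (I : Type u) [AddCommGroup I] [Module R I]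
    [Module.Injective R I] : Function.Bijective (evaluation R S C I) := by
  have := (hC.finite_right.hasFiniteSyzygies 1).finitePresentation
  obtain ⟨m, l, e, s, hgen, hrel, huniv⟩ := exists_generators_relations (A := Sᵐᵒᵖ) C
  constructor
  · rw [injective_iff_map_eq_zero]
    intro t ht
    obtain ⟨d, rfl⟩ := BalancedTensor.exists_sum_tmul hgen t
    have ht' : ∑ a, d a (e a) = 0 := by simpa using ht
    obtain ⟨d', hd'⟩ := exists_relations_of_pairing_eq_zero s d (by
      intro c hc
      obtain ⟨g, hg⟩ := huniv C c hc
      obtain ⟨r, rfl⟩ := hC.bijective_homothetyLeft.2 g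
      have : ∀ a, c a = r • e a := fun a => (hg a).symm
      simp only [this, map_smul]
      rw [← Finset.smul_sum, ht', smul_zero])
    have hsum : ∀ a, BalancedTensor.tmul R S C (e a) (d a) =
        ∑ b, BalancedTensor.tmul R S C (s b a • e a) (d' b) := by
      intro a
      rw [hd']
      refine (map_sum (AddMonoidHom.mk' (fun x => BalancedTensor.tmul R S C (e a) x)
        fun x y => BalancedTensor.tmul_add (e a) x y) _ _).trans ?_
      exact Finset.sum_congr rfl fun b _ => BalancedTensor.tmul_smul _ _ _
    simp only [hsum]
    rw [Finset.sum_comm]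
    refine Finset.sum_eq_zero fun b _ => ?_
    refine (map_sum (AddMonoidHom.mk' (fun c => BalancedTensor.tmul R S C c (d' b))
      fun c c' => BalancedTensor.add_tmul c c' (d' b)) _ _).symm.trans ?_
    rw [hrel, map_zero]
  · intro x
    let T : R →ₗ[R] (Fin m → C) := LinearMap.toSpanSingleton R _ e
    obtain ⟨E, hE⟩ := exists_factor_of_injective T (LinearMap.toSpanSingleton R I x) (by
      intro r hr
      have hr' : ∀ a, r • e a = 0 := fun a => congrFun (LinearMap.mem_ker.1 hr) a
      have : r = 0 := by
        refine hC.bijective_homothetyLeft.1 (LinearMap.ext fun c => ?_)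
        obtain ⟨t, rfl⟩ := hgen c
        change r • (∑ a, t a • e a) = (0 : R) • (∑ a, t a • e a)
        rw [zero_smul, Finset.smul_sum]
        exact Finset.sum_eq_zero fun a _ => by rw [smul_comm, hr', smul_zero]
      rw [this]
      exact zero_mem _)
    refine ⟨∑ a, BalancedTensor.tmul R S C (e a)
      (show HomModule R C I from E ∘ₗ LinearMap.single R (fun _ => C) a), ?_⟩
    rw [map_sum]
    have h1 : E e = x := by
      have := hE 1
      rwa [LinearMap.toSpanSingleton_apply, LinearMap.toSpanSingleton_apply, one_smul,
        one_smul] at this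
    change ∑ a, E (Pi.single a (e a)) = x
    rw [← map_sum, Finset.univ_sum_single, h1]

/-- `Hom_R(C, I)` lies in the Auslander class for every injective `I`. -/
theorem IsSemidualizing.inAuslanderClass_homModule (I : Type u) [AddCommGroup I] [Module R I]
    [Module.Injective R I] : InAuslanderClass R S C (ModuleCat.of S (HomModule R C I)) := by
  have hev := hC.evaluation_bijective I
  refine (inAuslanderClass_iff _).2 ⟨fun i => ?_, fun i => ?_, ?_⟩
  · exact ext_homModule_character i (ModuleCat.of Sᵐᵒᵖ C) (hC.finite_right.hasFiniteSyzygies _)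
      fun n => hC.ext_right (n + 1) (by omega)
  · have hI : Injective (ModuleCat.of R I) := (Module.injective_iff_injective_object R I).1 ‹_›
    have : Injective (ModuleCat.of R (BalancedTensor R S C (HomModule R C I))) :=
      Injective.of_iso (LinearEquiv.ofBijective _ hev).toModuleIso.symm hI
    exact Abelian.Ext.subsingleton_of_injective _ _ i
  · have hinv : ∀ d : HomModule R C I, HomModule.map (S := S) (C := C) (evaluation R S C I)
        (valuation R S C (HomModule R C I) d) = d := fun d => rfl
    refine ⟨Function.LeftInverse.injective hinv, fun φ =>
      ⟨HomModule.map (S := S) (C := C) (evaluation R S C I) φ, ?_⟩⟩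
    exact HomModule.map_injective _ hev.1 (hinv _)

omit hC in
theorem InAuslanderClass.of_subsingleton (N : ModuleCat.{u} S) [Subsingleton N] :
    InAuslanderClass R S C N := by
  have hT : ∀ t : BalancedTensor R S C N, t = 0 := by
    intro t
    induction t using BalancedTensor.induction with
    | tmul c x => rw [Subsingleton.elim x 0, BalancedTensor.tmul_zero]
    | add y z hy hz => rw [hy, hz, add_zero]
  have hN : Projective N := (ModuleCat.isZero_of_subsingleton N).projective
  have : Subsingleton (BalancedTensor R S C N) := subsingleton_of_forall_eq 0 hT
  have hTN : Injective (ModuleCat.of R (BalancedTensor R S C N)) :=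
    (ModuleCat.isZero_of_subsingleton _).injective
  exact (inAuslanderClass_iff _).2 ⟨fun i => Abelian.Ext.subsingleton_of_projective _ _ i,
    fun i => Abelian.Ext.subsingleton_of_injective _ _ i, Function.injective_of_subsingleton _,
    fun φ => ⟨0, LinearMap.ext fun c => Subsingleton.elim _ _⟩⟩

-- Isomorphism invariance is read off from closure under kernels, applied to 0 → N' → N → 0 → 0.
omit hC in
theorem InAuslanderClass.of_linearEquiv {N N' : ModuleCat.{u} S} (e : N ≃ₗ[S] N')
    (h : InAuslanderClass R S C N) : InAuslanderClass R S C N' :=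
  InAuslanderClass.kernel (N := ModuleCat.of S PUnit) (f := e.symm.toLinearMap) (g := 0)
    e.symm.injective (fun _ => ⟨fun _ => ⟨e _, e.symm_apply_apply _⟩, fun _ => rfl⟩)
    (fun _ => ⟨0, rfl⟩) h (InAuslanderClass.of_subsingleton _)

theorem IsSemidualizing.cInjective_le_auslanderClass :
    cInjective R S C ≤ auslanderClass R S C := by
  rintro N ⟨I, hI, ⟨e⟩⟩
  have := (Module.injective_iff_injective_object R I).2 hI
  exact (hC.inAuslanderClass_homModule I).of_linearEquiv e.symm

/-- Every module in the Auslander class embeds into a `C`-injective module with cokernel in the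
Auslander class. -/
theorem IsSemidualizing.exists_cInjective_embedding (N : ModuleCat.{u} S)
    (hN : InAuslanderClass R S C N) :
    ∃ (U V : ModuleCat.{u} S) (f : N →ₗ[S] U) (g : U →ₗ[S] V), cInjective R S C U ∧
      InAuslanderClass R S C V ∧ Function.Injective f ∧ Function.Exact f g ∧
      Function.Surjective g := by
  let T := ModuleCat.of R (BalancedTensor R S C N)
  let I := Injective.under T
  let ι : BalancedTensor R S C N →ₗ[R] I := (Injective.ι T).hom
  have hι : Function.Injective ι := (ModuleCat.mono_iff_injective _).1 (Injective.ι_mono T)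
  have hI : Injective I := inferInstance
  have : Module.Injective R I := (Module.injective_iff_injective_object R I).2 hI
  let j : N →ₗ[S] HomModule R C I := HomModule.map (S := S) (C := C) ι ∘ₗ valuation R S C N
  have hj : Function.Injective j :=
    (HomModule.map_injective (S := S) (C := C) ι hι).comp hN.bijective_valuation.1
  -- Evaluation composed with C ⊗ j is the embedding ι, so C ⊗ j is injective, as
  -- `InAuslanderClass.cokernel` demands.
  have hTj : Function.Injective (BalancedTensor.map R S C j) := by
    have : ∀ t, evaluation R S C I (BalancedTensor.map R S C j t) = ι t := by
      intro t
      induction t using BalancedTensor.induction with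
      | tmul c x => rfl
      | add y z hy hz => rw [map_add, map_add, map_add, hy, hz]
    intro x y hxy
    exact hι (by rw [← this, ← this, hxy])
  refine ⟨ModuleCat.of S (HomModule R C I), ModuleCat.of S (HomModule R C I ⧸ LinearMap.range j), j,
    Submodule.mkQ _, ⟨I, hI, ⟨LinearEquiv.refl _ _⟩⟩, ?_, hj, LinearMap.exact_map_mkQ_range j,
    Submodule.mkQ_surjective _⟩
  exact InAuslanderClass.cokernel (L := N) (M := ModuleCat.of S (HomModule R C I)) hj
    (LinearMap.exact_map_mkQ_range j) (Submodule.mkQ_surjective _) hN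
    (hC.inAuslanderClass_homModule I) hTj

end CInjective

/-! ### Pushouts and quotients of short exact sequences. -/

section Diagrams

variable {S : Type u} [Ring S]

/-- The pushout of two short exact sequences with the same left term. -/
theorem exists_pushout {K X N Y B : ModuleCat.{u} S} {i : K →ₗ[S] X} {p : X →ₗ[S] N}
    {a : K →ₗ[S] Y} {b : Y →ₗ[S] B} (hi : Function.Injective i) (hip : Function.Exact i p)
    (hp : Function.Surjective p) (ha : Function.Injective a) (hab : Function.Exact a b)
    (hb : Function.Surjective b) :
    ∃ (Q : ModuleCat.{u} S) (u : Y →ₗ[S] Q) (q : Q →ₗ[S] N) (v : X →ₗ[S] Q) (r : Q →ₗ[S] B),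
      Function.Injective u ∧ Function.Exact u q ∧ Function.Surjective q ∧
      Function.Injective v ∧ Function.Exact v r ∧ Function.Surjective r := by
  -- The pushout is (Y × X) / {(a k, -i k)}, which identifies the two copies of K.
  let W : Submodule S (Y × X) := LinearMap.range (a.prod (-i))
  have hWp : W ≤ LinearMap.ker (p ∘ₗ LinearMap.snd S Y X) := by
    rintro _ ⟨k, rfl⟩
    simp [hip.apply_apply_eq_zero]
  have hWb : W ≤ LinearMap.ker (b ∘ₗ LinearMap.fst S Y X) := by
    rintro _ ⟨k, rfl⟩
    simp [hab.apply_apply_eq_zero]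
  refine ⟨ModuleCat.of S ((Y × X) ⧸ W), W.mkQ ∘ₗ LinearMap.inl S Y X, W.liftQ _ hWp,
    W.mkQ ∘ₗ LinearMap.inr S Y X, W.liftQ _ hWb, ?_, ?_, ?_, ?_, ?_, ?_⟩
  · rw [injective_iff_map_eq_zero]
    intro y hy
    obtain ⟨k, hk⟩ := (Submodule.Quotient.mk_eq_zero W).1 hy
    obtain ⟨h1, h2⟩ := Prod.ext_iff.1 hk
    have : k = 0 := hi (by simpa using h2)
    simpa [this] using h1.symm
  · intro t
    obtain ⟨⟨y, x⟩, rfl⟩ := Submodule.mkQ_surjective W t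
    constructor
    · intro h
      obtain ⟨k, rfl⟩ := (hip x).1 h
      exact ⟨y + a k, (Submodule.Quotient.eq W).2 ⟨k, by simp⟩⟩
    · rintro ⟨y', hy'⟩
      rw [← hy']
      exact map_zero p
  · intro z
    obtain ⟨x, rfl⟩ := hp z
    exact ⟨W.mkQ (0, x), rfl⟩
  · rw [injective_iff_map_eq_zero]
    intro x hx
    obtain ⟨k, hk⟩ := (Submodule.Quotient.mk_eq_zero W).1 hx
    obtain ⟨h1, h2⟩ := Prod.ext_iff.1 hk
    have : k = 0 := ha (by simpa using h1)
    simpa [this] using h2.symm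
  · intro t
    obtain ⟨⟨y, x⟩, rfl⟩ := Submodule.mkQ_surjective W t
    constructor
    · intro h
      obtain ⟨k, rfl⟩ := (hab y).1 h
      exact ⟨x + i k, (Submodule.Quotient.eq W).2 ⟨-k, by simp⟩⟩
    · rintro ⟨x', hx'⟩
      rw [← hx']
      exact map_zero b
  · intro z
    obtain ⟨y, rfl⟩ := hb z
    exact ⟨W.mkQ (y, 0), rfl⟩

/-- Given short exact sequences `0 → K → Q → N → 0` and `0 → Q → U → V → 0`, the quotient `U / K`
is an extension of `V` by `N`. -/
theorem exists_quotient {K Q N U V : ModuleCat.{u} S} {i : K →ₗ[S] Q} {p : Q →ₗ[S] N}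
    {w : Q →ₗ[S] U} {z : U →ₗ[S] V} (hi : Function.Injective i) (hip : Function.Exact i p)
    (hp : Function.Surjective p) (hw : Function.Injective w) (hwz : Function.Exact w z)
    (hz : Function.Surjective z) :
    ∃ (H : ModuleCat.{u} S) (j : K →ₗ[S] U) (q : U →ₗ[S] H) (f : N →ₗ[S] H) (g : H →ₗ[S] V),
      Function.Injective j ∧ Function.Exact j q ∧ Function.Surjective q ∧
      Function.Injective f ∧ Function.Exact f g ∧ Function.Surjective g := by
  let W : Submodule S U := LinearMap.range (w ∘ₗ i)
  have hker : LinearMap.ker p ≤ LinearMap.ker (W.mkQ ∘ₗ w) := by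
    intro x hx
    obtain ⟨k, rfl⟩ := (hip x).1 hx
    exact (Submodule.Quotient.mk_eq_zero W).2 ⟨k, rfl⟩
  have hWz : W ≤ LinearMap.ker z := by
    rintro _ ⟨k, rfl⟩
    exact hwz.apply_apply_eq_zero (i k)
  let f : N →ₗ[S] U ⧸ W := (LinearMap.ker p).liftQ _ hker ∘ₗ
    (p.quotKerEquivOfSurjective hp).symm.toLinearMap
  have hf : ∀ x, f (p x) = W.mkQ (w x) := fun x => by
    have : (p.quotKerEquivOfSurjective hp).symm (p x) = (LinearMap.ker p).mkQ x := by
      rw [LinearEquiv.symm_apply_eq]; rfl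
    simp [f, this]
  refine ⟨ModuleCat.of S (U ⧸ W), w ∘ₗ i, W.mkQ, f, W.liftQ z hWz, hw.comp hi,
    LinearMap.exact_map_mkQ_range _, W.mkQ_surjective, ?_, ?_, ?_⟩
  · rw [injective_iff_map_eq_zero]
    intro y hy
    obtain ⟨x, rfl⟩ := hp y
    rw [hf] at hy
    obtain ⟨k, hk⟩ := (Submodule.Quotient.mk_eq_zero W).1 hy
    rw [← hw hk, hip.apply_apply_eq_zero]
  · intro t
    obtain ⟨t, rfl⟩ := W.mkQ_surjective t
    constructor
    · intro h
      obtain ⟨x, rfl⟩ := (hwz t).1 h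
      exact ⟨p x, hf x⟩
    · rintro ⟨y, hy⟩
      obtain ⟨x, rfl⟩ := hp y
      rw [← hy, hf]
      exact hwz.apply_apply_eq_zero x
  · intro v
    obtain ⟨t, rfl⟩ := hz v
    exact ⟨W.mkQ t, rfl⟩

end Diagrams

/-! ### Splitting and splicing resolutions; relative dimension. -/

section Resolutions

variable {S : Type u} [Ring S] {𝒳 𝒴 : ObjectProperty (ModuleCat.{u} S)}

theorem HasResolutionOfLength.mono (h : 𝒳 ≤ 𝒴) {N : ModuleCat.{u} S} {n : ℕ}
    (hN : HasResolutionOfLength 𝒳 N n) : HasResolutionOfLength 𝒴 N n := by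
  obtain ⟨X, d, ε, h1, h2⟩ := hN
  exact ⟨X, d, ε, fun i hi => h _ (h1 i hi), h2⟩

theorem hasResolutionOfLength_zero_iff (N : ModuleCat.{u} S) :
    HasResolutionOfLength 𝒳 N 0 ↔ ∃ X : ModuleCat.{u} S, 𝒳 X ∧ Nonempty (X ≃ₗ[S] N) := by
  constructor
  · rintro ⟨X, d, ε, h1, h2, h3, h4, -⟩
    have := h2 1 one_pos
    refine ⟨X 0, h1 0 le_rfl, ⟨LinearEquiv.ofBijective ε ⟨?_, h3⟩⟩⟩
    rw [injective_iff_map_eq_zero]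
    intro x hx
    obtain ⟨y, rfl⟩ := (h4 x).1 hx
    rw [Subsingleton.elim y 0, map_zero]
  · rintro ⟨X, hX, ⟨e⟩⟩
    refine ⟨fun | 0 => X | _ + 1 => ModuleCat.of S PUnit, fun _ => 0, e.toLinearMap, ?_, ?_,
      e.surjective, ?_, ?_⟩
    · rintro i hi
      obtain rfl := Nat.le_zero.1 hi
      exact hX
    · rintro (_ | i) hi
      · exact absurd hi (lt_irrefl 0)
      · exact inferInstanceAs (Subsingleton PUnit)
    · intro x
      refine ⟨fun hx => ⟨0, (e.map_eq_zero_iff.1 hx).symm⟩, ?_⟩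
      rintro ⟨y, rfl⟩
      exact map_zero e
    · intro i x
      exact ⟨fun _ => ⟨0, rfl⟩, fun _ => rfl⟩

theorem hasResolutionOfLength_succ_iff (N : ModuleCat.{u} S) (n : ℕ) :
    HasResolutionOfLength 𝒳 N (n + 1) ↔
      ∃ (K X : ModuleCat.{u} S) (f : K →ₗ[S] X) (g : X →ₗ[S] N), 𝒳 X ∧ Function.Injective f ∧
        Function.Exact f g ∧ Function.Surjective g ∧ HasResolutionOfLength 𝒳 K n := by
  constructor
  · rintro ⟨X, d, ε, h1, h2, h3, h4, h5⟩
    refine ⟨ModuleCat.of S (LinearMap.ker ε), X 0, Submodule.subtype _, ε, h1 0 (Nat.zero_le _),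
      Subtype.val_injective, LinearMap.exact_subtype_ker_map ε, h3, fun i => X (i + 1),
      fun i => d (i + 1), (d 0).codRestrict _ fun x => h4.apply_apply_eq_zero x,
      fun i hi => h1 _ (Nat.succ_le_succ hi), fun i hi => h2 _ (Nat.succ_lt_succ hi), ?_, ?_,
      fun i => h5 (i + 1)⟩
    · rintro ⟨x, hx⟩
      obtain ⟨y, rfl⟩ := (h4 x).1 hx
      exact ⟨y, rfl⟩
    · intro x
      rw [← h5 0 x, ← Subtype.coe_inj]
      rfl
  · rintro ⟨K, X₀, f, g, hX₀, hf, hfg, hg, X, d, ε, h1, h2, h3, h4, h5⟩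
    refine ⟨fun | 0 => X₀ | i + 1 => X i, fun | 0 => f ∘ₗ ε | i + 1 => d i, g, ?_, ?_, hg, ?_, ?_⟩
    · rintro (_ | i) hi
      · exact hX₀
      · exact h1 i (Nat.le_of_succ_le_succ hi)
    · rintro (_ | i) hi
      · exact absurd hi (Nat.not_lt_zero _)
      · exact h2 i (Nat.lt_of_succ_lt_succ hi)
    · intro x
      refine (hfg x).trans ⟨?_, ?_⟩
      · rintro ⟨k, rfl⟩
        obtain ⟨y, rfl⟩ := h3 k
        exact ⟨y, rfl⟩
      · rintro ⟨y, rfl⟩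
        exact ⟨ε y, rfl⟩
    · rintro (_ | i) x
      · refine Iff.trans ?_ (h4 x)
        exact ⟨fun h => hf (h.trans (map_zero f).symm), fun h => (congrArg f h).trans (map_zero f)⟩
      · exact h5 i x

/-- A finite infimum of natural numbers is attained, and the infimum over the empty set is ⊤. -/
theorem relPd_eq_coe_iff (N : ModuleCat.{u} S) (n : ℕ) :
    relPd 𝒳 N = n ↔ HasResolutionOfLength 𝒳 N n ∧
      ∀ m, HasResolutionOfLength 𝒳 N m → n ≤ m := by
  classical
  have key : ∀ n, HasResolutionOfLength 𝒳 N n → (∀ m, HasResolutionOfLength 𝒳 N m → n ≤ m) →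
      relPd 𝒳 N = n := fun n h1 h2 =>
    le_antisymm (iInf₂_le n h1) (le_iInf₂ fun m hm => Nat.cast_le.2 (h2 m hm))
  refine ⟨fun h => ?_, fun h => key n h.1 h.2⟩
  by_cases hex : ∃ m, HasResolutionOfLength 𝒳 N m
  · have h' := key (Nat.find hex) (Nat.find_spec hex) fun m hm => Nat.find_min' hex hm
    obtain rfl : Nat.find hex = n := Nat.cast_injective (R := ℕ∞) (h'.symm.trans h)
    exact ⟨Nat.find_spec hex, fun m hm => Nat.find_min' hex hm⟩
  · exfalso
    have : relPd 𝒳 N = ⊤ := iInf₂_eq_top.2 fun m hm => absurd ⟨m, hm⟩ hex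
    exact ENat.natCast_ne_top n (h.symm.trans this)

end Resolutions

/-! ### Abstract Auslander–Buchweitz approximation. -/

section Approximations

variable {S : Type u} [Ring S]

/-- The hypotheses of Auslander–Buchweitz approximation theory: `𝒜` is closed under isomorphisms,
extensions and kernels of epimorphisms, and `ℐ` is a cogenerator for `𝒜`. -/
structure IsCogeneratedBy (𝒜 ℐ : ObjectProperty (ModuleCat.{u} S)) : Prop where
  le : ℐ ≤ 𝒜
  of_linearEquiv : ∀ {M N : ModuleCat.{u} S}, (M ≃ₗ[S] N) → 𝒜 M → 𝒜 N
  extension : ∀ {L M N : ModuleCat.{u} S} {f : L →ₗ[S] M} {g : M →ₗ[S] N}, Function.Injective f →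
    Function.Exact f g → Function.Surjective g → 𝒜 L → 𝒜 N → 𝒜 M
  kernel : ∀ {L M N : ModuleCat.{u} S} {f : L →ₗ[S] M} {g : M →ₗ[S] N}, Function.Injective f →
    Function.Exact f g → Function.Surjective g → 𝒜 M → 𝒜 N → 𝒜 L
  exists_embedding : ∀ N : ModuleCat.{u} S, 𝒜 N →
    ∃ (U V : ModuleCat.{u} S) (f : N →ₗ[S] U) (g : U →ₗ[S] V), ℐ U ∧ 𝒜 V ∧
      Function.Injective f ∧ Function.Exact f g ∧ Function.Surjective g

variable {𝒜 ℐ : ObjectProperty (ModuleCat.{u} S)} (h : IsCogeneratedBy 𝒜 ℐ)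
include h

/-- The two sequences are proved together: the second one for K at length n produces the first one
for N at length n + 1, which in turn produces the second. -/
theorem IsCogeneratedBy.exists_approximations (n : ℕ) : ∀ N : ModuleCat.{u} S,
    HasResolutionOfLength 𝒜 N n →
    (∃ (H A : ModuleCat.{u} S) (f : H →ₗ[S] A) (g : A →ₗ[S] N),
      Function.Injective f ∧ Function.Exact f g ∧ Function.Surjective g ∧ 𝒜 A ∧
      (n = 0 → Subsingleton H) ∧ (1 ≤ n → HasResolutionOfLength ℐ H (n - 1))) ∧
    (∃ (H A : ModuleCat.{u} S) (f : N →ₗ[S] H) (g : H →ₗ[S] A),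
      Function.Injective f ∧ Function.Exact f g ∧ Function.Surjective g ∧ 𝒜 A ∧
      HasResolutionOfLength ℐ H n) := by
  induction n with
  | zero =>
    intro N hN
    obtain ⟨X, hX, ⟨e⟩⟩ := (hasResolutionOfLength_zero_iff N).1 hN
    have hN' : 𝒜 N := h.of_linearEquiv e hX
    refine ⟨⟨ModuleCat.of S PUnit, N, 0, LinearMap.id, Function.injective_of_subsingleton _, ?_,
      Function.surjective_id, hN', fun _ => inferInstanceAs (Subsingleton PUnit),
      fun h0 => absurd h0 (by omega)⟩, ?_⟩
    · intro x
      exact ⟨fun hx => ⟨0, hx.symm⟩, by rintro ⟨_, rfl⟩; rfl⟩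
    · obtain ⟨U, V, f, g, hU, hV, hf, hfg, hg⟩ := h.exists_embedding N hN'
      exact ⟨U, V, f, g, hf, hfg, hg, hV,
        (hasResolutionOfLength_zero_iff U).2 ⟨U, hU, ⟨LinearEquiv.refl _ _⟩⟩⟩
  | succ n ih =>
    intro N hN
    obtain ⟨K, X, i, p, hX, hi, hip, hp, hK⟩ := (hasResolutionOfLength_succ_iff N n).1 hN
    obtain ⟨K', B, a, b, ha, hab, hb, hB, hK'⟩ := (ih K hK).2
    obtain ⟨Q, u, q, v, r, hu, huq, hq, hv, hvr, hr⟩ := exists_pushout hi hip hp ha hab hb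
    have hQ : 𝒜 Q := h.extension hv hvr hr hX hB
    refine ⟨⟨K', Q, u, q, hu, huq, hq, hQ, fun h0 => absurd h0 (by omega), fun _ => hK'⟩, ?_⟩
    obtain ⟨U, V, w, z, hU, hV, hw, hwz, hz⟩ := h.exists_embedding Q hQ
    obtain ⟨H, j, t, f, g, hj, hjt, ht, hf, hfg, hg⟩ := exists_quotient hu huq hq hw hwz hz
    exact ⟨H, V, f, g, hf, hfg, hg, hV,
      (hasResolutionOfLength_succ_iff H n).2 ⟨K', U, j, t, hU, hj, hjt, ht, hK'⟩⟩

/-- The first step X → H of the resolution is pulled back along N → H. The pullback is the kernel of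
X → H → A, hence in 𝒜, and it maps onto N with the same kernel K as X → H. -/
theorem IsCogeneratedBy.hasResolutionOfLength_left {N H A : ModuleCat.{u} S} {f : N →ₗ[S] H}
    {g : H →ₗ[S] A} (hf : Function.Injective f) (hfg : Function.Exact f g)
    (hg : Function.Surjective g) (hA : 𝒜 A) {m : ℕ} (hH : HasResolutionOfLength ℐ H m) :
    HasResolutionOfLength 𝒜 N m := by
  cases m with
  | zero =>
    obtain ⟨X, hX, ⟨e⟩⟩ := (hasResolutionOfLength_zero_iff H).1 hH
    exact (hasResolutionOfLength_zero_iff N).2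
      ⟨N, h.kernel hf hfg hg (h.of_linearEquiv e (h.le _ hX)) hA, ⟨LinearEquiv.refl _ _⟩⟩
  | succ m =>
    obtain ⟨K, X, i, p, hX, hi, hip, hp, hK⟩ := (hasResolutionOfLength_succ_iff H m).1 hH
    have hmem : ∀ x : LinearMap.ker (g ∘ₗ p), p x ∈ LinearMap.range f := fun x => (hfg _).1 x.2
    let P := ModuleCat.of S (LinearMap.ker (g ∘ₗ p))
    have hP : 𝒜 P := h.kernel (f := Submodule.subtype _) (g := g ∘ₗ p) Subtype.val_injective
      (LinearMap.exact_subtype_ker_map _) (hg.comp hp) (h.le _ hX) hA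
    let e := LinearEquiv.ofInjective f hf
    let j : K →ₗ[S] P := i.codRestrict _ fun k => by
      simp [hip.apply_apply_eq_zero]
    let π : P →ₗ[S] N := e.symm.toLinearMap ∘ₗ
      (p ∘ₗ Submodule.subtype (LinearMap.ker (g ∘ₗ p))).codRestrict (LinearMap.range f) hmem
    have hπ : ∀ x : P, f (π x) = p x.1 := fun x =>
      congrArg Subtype.val (e.apply_symm_apply ⟨p x.1, hmem x⟩)
    refine (hasResolutionOfLength_succ_iff N m).2 ⟨K, P, j, π, hP,
      fun x y hxy => hi (congrArg Subtype.val hxy), fun x => ?_, fun y => ?_, hK.mono h.le⟩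
    · have : π x = 0 ↔ p x.1 = 0 := by rw [← hπ, map_eq_zero_iff f hf]
      rw [this, hip x.1]
      constructor
      · rintro ⟨k, hk⟩
        exact ⟨k, Subtype.ext hk⟩
      · rintro ⟨k, rfl⟩
        exact ⟨k, rfl⟩
    · obtain ⟨x, hx⟩ := hp (f y)
      have hx' : x ∈ LinearMap.ker (g ∘ₗ p) := by simp [hx, hfg.apply_apply_eq_zero]
      exact ⟨⟨x, hx'⟩, hf ((hπ ⟨x, hx'⟩).trans hx)⟩

theorem IsCogeneratedBy.exists_approximations_relPd (N : ModuleCat.{u} S) (n : ℕ)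
    (hN : relPd 𝒜 N = (n : ℕ∞)) :
    (∃ (H A : ModuleCat.{u} S) (f : H →ₗ[S] A) (g : A →ₗ[S] N),
      Function.Injective f ∧ Function.Exact f g ∧ Function.Surjective g ∧ 𝒜 A ∧
      (n = 0 → Subsingleton H) ∧ (1 ≤ n → relPd ℐ H = ((n - 1 : ℕ) : ℕ∞))) ∧
    (∃ (H A : ModuleCat.{u} S) (f : N →ₗ[S] H) (g : H →ₗ[S] A),
      Function.Injective f ∧ Function.Exact f g ∧ Function.Surjective g ∧ 𝒜 A ∧
      relPd ℐ H = (n : ℕ∞)) := by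
  obtain ⟨hres, hmin⟩ := (relPd_eq_coe_iff N n).1 hN
  obtain ⟨⟨H, A, f, g, hf, hfg, hg, hA, hH, hH'⟩, H₁, A₁, f₁, g₁, hf₁, hfg₁, hg₁, hA₁, hH₁⟩ :=
    h.exists_approximations n N hres
  refine ⟨⟨H, A, f, g, hf, hfg, hg, hA, hH, fun hn => (relPd_eq_coe_iff H _).2 ⟨hH' hn, ?_⟩⟩,
    H₁, A₁, f₁, g₁, hf₁, hfg₁, hg₁, hA₁, (relPd_eq_coe_iff H₁ n).2 ⟨hH₁, fun m hm =>
      hmin m (h.hasResolutionOfLength_left hf₁ hfg₁ hg₁ hA₁ hm)⟩⟩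
  intro m hm
  -- An ℐ-resolution of H of length m, spliced with A → N, is an 𝒜-resolution of N of length m + 1;
  -- hence n ≤ m + 1.
  have := hmin (m + 1) ((hasResolutionOfLength_succ_iff N m).2
    ⟨H, A, f, g, hA, hf, hfg, hg, hm.mono h.le⟩)
  omega

end Approximations

theorem IsSemidualizing.isCogeneratedBy {R S : Type u} [Ring R] [Ring S] {C : Type u}
    [AddCommGroup C] [Module R C] [Module Sᵐᵒᵖ C] [SMulCommClass R Sᵐᵒᵖ C]
    (hC : IsSemidualizing R S C) : IsCogeneratedBy (auslanderClass R S C) (cInjective R S C) where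
  le := hC.cInjective_le_auslanderClass
  of_linearEquiv := InAuslanderClass.of_linearEquiv
  extension := InAuslanderClass.extension
  kernel := InAuslanderClass.kernel
  exists_embedding := hC.exists_cInjective_embedding

end SemidualizingBimodule

/-- Let `C` be a semidualizing `(R, S)`-bimodule and `N` a left `S`-module of finite Auslander projective
dimension `n`. Then there are exact sequences `0 → H → A → N → 0` and `0 → N → H' → A' → 0` with `A`, `A'`
in the Auslander class, `ℐ_C(S)`-pd `H = n - 1` (which means `H = 0` if `n = 0`), and
`ℐ_C(S)`-pd `H' = n`. -/
theorem corollary4p6 {R S : Type u} [Ring R] [Ring S]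
    {C : Type u} [AddCommGroup C] [Module R C] [Module Sᵐᵒᵖ C] [SMulCommClass R Sᵐᵒᵖ C]
    (hC : SemidualizingBimodule.IsSemidualizing R S C)
    (N : ModuleCat.{u} S) (n : ℕ)
    (hN : SemidualizingBimodule.relPd (SemidualizingBimodule.auslanderClass R S C) N = (n : ℕ∞)) :
    (∃ (H A : ModuleCat.{u} S) (f : H →ₗ[S] A) (g : A →ₗ[S] N),
      Function.Injective f ∧ Function.Exact f g ∧ Function.Surjective g ∧
      SemidualizingBimodule.auslanderClass R S C A ∧
      (n = 0 → Subsingleton H) ∧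
      (1 ≤ n → SemidualizingBimodule.relPd (SemidualizingBimodule.cInjective R S C) H =
        ((n - 1 : ℕ) : ℕ∞))) ∧
    (∃ (H' A' : ModuleCat.{u} S) (f' : N →ₗ[S] H') (g' : H' →ₗ[S] A'),
      Function.Injective f' ∧ Function.Exact f' g' ∧ Function.Surjective g' ∧
      SemidualizingBimodule.auslanderClass R S C A' ∧
      SemidualizingBimodule.relPd (SemidualizingBimodule.cInjective R S C) H' = (n : ℕ∞)) :=
  hC.isCogeneratedBy.exists_approximations_relPd N n hN
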